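/- Let $A=\bigoplus_{u\ge 0}A_u$ be a standard graded algebra over a field $k$ (that is, $A_0=k$ and $A$ is generated over $k$ by finitely many elements of $A_1$). Let $r\ge 1$ and let $f_1,\dots,f_r\in A$ be homogeneous elements with $\deg f_j=d_j$ and $d_1\le\dots\le d_r$, forming a $d$-sequence: $f_i\notin(f_1,\dots,f_{i-1},f_{i+1},\dots,f_r)$ for $1\le i\le r$, and $(f_1,\dots,f_i):f_{i+1}f_j=(f_1,\dots,f_i):f_j$ for all $i\ge 0$ and $i+1\le j\le r$. Put $I=(f_1,\dots,f_r)$ and $I_q=(f_1,\dots,f_{q-1}):f_q$ for $q=1,\dots,r$. Bigrade the Rees algebra $A[It]=\bigoplus_{v\ge0}I^vt^v$ by $A[It]_{(u,v)}=(I^v)_u\,t^v$. Its Hilbert polynomial is the polynomial $P_{A[It]}\in\mathbb{Q}[u,v]$ such that, with $d=\max_j d_j$ and some integers $u_0,v_0$, one has $\dim_k A[It]_{(u,v)}=P_{A[It]}(u,v)$ for all $u\ge dv+u_0$, $v\ge v_0$. The zero polynomial is given degree $-1$. If $\deg P_{A[It]}=s\ge 0$, the mixed multiplicities $e_i(A[It])$,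 $0\le i\le s$, are defined by $$P_{A[It]}(u,v)=\sum_{i=0}^{s}\frac{e_i(A[It])}{i!\,(s-i)!}u^iv^{s-i}+\text{lower-degree terms}.$$ For a homogeneous ideal $J$ of $A$, let $e(A/J)$ be the multiplicity of $A/J$, i.e. $\delta!$ times the leading coefficient of the Hilbert polynomial of $A/J$ if that polynomial is nonzero of degree $\delta$, and $\dim_k A/J$ if it is zero. Set $s=\dim A/I_1-1$ and $m=\max\{q \mid 1\le q\le r,\ \dim A/I_q+q-2=s\}$. Then the Hilbert polynomial $P_{A[It]}$ exists, $\deg P_{A[It]}=s$, and for $i=0,\dots,s$ $$e_i(A[It])=\sum_{q=1}^{\min\{m,\,s-i+1\}}(-1)^{s-q-i+1}\,e(A/I_q)\sum_{j_1+\dots+j_q=s-q-i+1}d_1^{\,j_1}\cdots d_q^{\,j_q},$$ where the inner sum runs over non-negative integers $j_1,\dots,j_q$ and $0^0=1$. -/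

import Mathlib

open Polynomial

/-- A graded `k`-algebra `A = ⨁ 𝒜 u` is standard graded: `A₀ = k`, and `A` is generated over `k` by
`A₁`, which is finite dimensional. -/
structure IsStandardGraded {k A : Type*} [Field k] [CommRing A] [Algebra k A]
    (𝒜 : ℕ → Submodule k A) : Prop where
  zero_eq : 𝒜 0 = LinearMap.range (Algebra.linearMap k A)
  finite_one : FiniteDimensional k (𝒜 1)
  adjoin_one : Algebra.adjoin k (𝒜 1 : Set A) = ⊤

/-- The ideal `I_q = (f_1, …, f_{q-1}) : f_q`; sequences are indexed from `1`. -/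
def colonIdeal {A : Type*} [CommRing A] (f : ℕ → A) (q : ℕ) : Ideal A :=
  (Ideal.span (f '' Set.Ico 1 q)).colon {f q}

/-- `f_1, …, f_r` is a `d`-sequence:
`f_i ∉ (f_1, …, f_{i-1}, f_{i+1}, …, f_r)` for `1 ≤ i ≤ r`, and
`(f_1, …, f_i) : f_{i+1} f_j = (f_1, …, f_i) : f_j` for all `0 ≤ i` and `i + 1 ≤ j ≤ r`. -/
structure IsDSequence {A : Type*} [CommRing A] (r : ℕ) (f : ℕ → A) : Prop where
  notMem : ∀ i ∈ Set.Icc 1 r, f i ∉ Ideal.span (f '' (Set.Icc 1 r \ {i}))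
  colon_eq : ∀ i j : ℕ, i + 1 ≤ j → j ≤ r →
    (Ideal.span (f '' Set.Icc 1 i)).colon {f (i + 1) * f j} =
      (Ideal.span (f '' Set.Icc 1 i)).colon {f j}

/-- The Hilbert function `u ↦ dim_k (A/J)_u` of `A/J` for a homogeneous ideal `J`, where `(A/J)_u`
is the image of `A_u` in `A/J`. -/
noncomputable def quotientHilbertFun {k A : Type*} [Field k] [CommRing A] [Algebra k A]
    (𝒜 : ℕ → Submodule k A) (J : Ideal A) (u : ℕ) : ℕ :=
  Module.finrank k ((𝒜 u).map (Ideal.Quotient.mkₐ k J).toLinearMap)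

/-- `p` is the Hilbert polynomial belonging to the Hilbert function `H`. -/
def IsHilbertPolynomial (H : ℕ → ℕ) (p : ℚ[X]) : Prop :=
  ∃ u₀ : ℕ, ∀ u : ℕ, u₀ ≤ u → (H u : ℚ) = p.eval (u : ℚ)

/-- `e` is the multiplicity of a graded object with Hilbert function `H`: if the Hilbert polynomial
has degree `δ ≥ 0` and leading coefficient `c` then `e = δ! * c`; if the Hilbert polynomial is zero
then `e` is the total dimension (the length). -/
def IsMultiplicity (H : ℕ → ℕ) (e : ℕ) : Prop :=
  ∃ p : ℚ[X], IsHilbertPolynomial H p ∧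
    ((p ≠ 0 ∧ (e : ℚ) = (p.natDegree.factorial : ℚ) * p.leadingCoeff) ∨
      (p = 0 ∧ e = ∑ᶠ u, H u))

/-- The bigraded piece `A[It]_{(u,v)} = (I^v)_u t^v` of the Rees algebra `A[It] ⊆ A[t]`. -/
def reesPiece {k A : Type*} [Field k] [CommRing A] [Algebra k A]
    (𝒜 : ℕ → Submodule k A) (I : Ideal A) (u v : ℕ) : Submodule k (reesAlgebra I) where
  carrier := {x | ∃ a : A, a ∈ I ^ v ∧ a ∈ 𝒜 u ∧ (x : A[X]) = monomial v a}
  zero_mem' := ⟨0, zero_mem _, zero_mem _, by simp⟩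
  add_mem' := by
    rintro x y ⟨a, ha, ha', hx⟩ ⟨b, hb, hb', hy⟩
    exact ⟨a + b, add_mem ha hb, add_mem ha' hb', by simp [hx, hy]⟩
  smul_mem' := by
    rintro c x ⟨a, ha, ha', hx⟩
    refine ⟨c • a, ?_, (𝒜 u).smul_mem c ha', ?_⟩
    · rw [Algebra.smul_def]
      exact Ideal.mul_mem_left _ _ ha
    · change c • (x : A[X]) = _
      rw [hx, Polynomial.smul_monomial]

/-- The Hilbert function `H(u,v) = dim_k A[It]_{(u,v)}` of the bigraded Rees algebra. -/
noncomputable def reesHilbertFun {k A : Type*} [Field k] [CommRing A] [Algebra k A]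
    (𝒜 : ℕ → Submodule k A) (I : Ideal A) (u v : ℕ) : ℕ :=
  Module.finrank k (reesPiece 𝒜 I u v)

/-- `P ∈ ℚ[u,v]` (`u` is the variable `0`, `v` the variable `1`) is the Hilbert polynomial of a
bigraded algebra with Hilbert function `H`, generated in bidegrees `(1,0), (d_1,1), …, (d_r,1)`
with `d = max d_j`: one has `H(u,v) = P(u,v)` whenever `u ≥ d v + u₀` and `v ≥ v₀`. -/
def IsBigradedHilbertPolynomial (d : ℕ) (H : ℕ → ℕ → ℕ) (P : MvPolynomial (Fin 2) ℚ) : Prop :=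
  ∃ u₀ v₀ : ℕ, ∀ u v : ℕ, d * v + u₀ ≤ u → v₀ ≤ v →
    (H u v : ℚ) = MvPolynomial.eval ![(u : ℚ), (v : ℚ)] P

/-- The total degree of `P`, with the convention that the zero polynomial has degree `-1`. -/
noncomputable def hilbertDegree (P : MvPolynomial (Fin 2) ℚ) : ℤ :=
  open Classical in if P = 0 then -1 else (P.totalDegree : ℤ)

/-- The mixed multiplicity `e_i` (`0 ≤ i ≤ s`) read off from the Hilbert polynomial
`P(u,v) = ∑_{i=0}^s e_i / (i! (s-i)!) u^i v^{s-i} + lower-degree terms`, where `s = deg P`. -/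
noncomputable def mixedMultiplicity (P : MvPolynomial (Fin 2) ℚ) (i : ℕ) : ℚ :=
  (i.factorial : ℚ) * ((P.totalDegree - i).factorial : ℚ) *
    P.coeff (Finsupp.single 0 i + Finsupp.single 1 (P.totalDegree - i))

/-! Write J_i = (f_1, …, f_i) and, for v ≥ 1, let h_i(v, u) be the dimension of the degree-u piece
of I^v / J_i I^(v-1). As J_0 = 0 and J_r = I, h_0 is the Hilbert function of A[It] and h_r = 0.
Multiplication by f_{i+1} gives h_i(v+1, u) = h_{i+1}(v+1, u) + h_i(v, u - d_{i+1}), and on the line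
v = 1 it gives h_i(1, u) = h_{i+1}(1, u) + dim (A/I_{i+1})_{u - d_{i+1}}. The first identity needs
multiplication to be injective on the quotients; this is where the `d`-sequence condition enters,
through `IsDSequence.mem_mul_pow` and `IsDSequence.pow_inf_colon`.

Descending from i = r, each h_i solves a difference equation in the direction (d_{i+1}, 1) with
prescribed values at v = 1. Such equations have polynomial solutions (`exists_bivShift_solution`),
and `exists_bivariate_of_recursion` follows the induction. On leading forms the difference operator
is a directional derivative, so the normalized leading coefficients obey a linear recursion, which
signed complete homogeneous sums solve (`mixedSum_succ`).

The Hilbert polynomial of A/I_q has degree dim A/I_q - 1, by comparing growth with a Noether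
normalization (`IsStandardGraded.exists_ringKrullDim`). Since f_q is a nonzerodivisor modulo I_q and
lies in I_{q+1} ⊇ I_q, the number dim A/I_q + q never increases. Hence that degree is at most s + 1
- q. For q ≤ s + 1, equality holds exactly when q ≤ m, and only these q contribute e(A/I_q) to the
leading form. -/

/-! ### Bivariate polynomials of bounded degree and the difference operator -/

/-- The bivariate polynomials all of whose monomials have degree `< n`. -/
def bivDegreeLT (n : ℕ) : Submodule ℚ (MvPolynomial (Fin 2) ℚ) where
  carrier := {P | ∀ m : Fin 2 →₀ ℕ, n ≤ m 0 + m 1 → P.coeff m = 0}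
  zero_mem' := fun m _ => MvPolynomial.coeff_zero m
  add_mem' := fun {P Q} hP hQ m hm => by
    rw [MvPolynomial.coeff_add, hP m hm, hQ m hm, add_zero]
  smul_mem' := fun c P hP m hm => by
    rw [MvPolynomial.coeff_smul, hP m hm, smul_zero]

/-- The exponent of the monomial `u^i v^l`. -/
noncomputable def bivExp (i l : ℕ) : Fin 2 →₀ ℕ := Finsupp.single 0 i + Finsupp.single 1 l

@[simp] lemma bivExp_zero (i l : ℕ) : bivExp i l 0 = i := by simp [bivExp]
@[simp] lemma bivExp_one (i l : ℕ) : bivExp i l 1 = l := by simp [bivExp]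

lemma bivExp_eta (m : Fin 2 →₀ ℕ) : bivExp (m 0) (m 1) = m := by
  ext i; fin_cases i <;> simp

lemma bivExp_add_single_zero (i l : ℕ) : bivExp i l + Finsupp.single 0 1 = bivExp (i + 1) l := by
  ext j; fin_cases j <;> simp [bivExp]

lemma bivExp_add_single_one (i l : ℕ) : bivExp i l + Finsupp.single 1 1 = bivExp i (l + 1) := by
  ext j; fin_cases j <;> simp [bivExp]

lemma bivDegreeLT_mono {m n : ℕ} (h : m ≤ n) : bivDegreeLT m ≤ bivDegreeLT n :=
  fun _ hP e he => hP e (h.trans he)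

lemma eq_zero_of_mem_bivDegreeLT_zero {P : MvPolynomial (Fin 2) ℚ} (h : P ∈ bivDegreeLT 0) :
    P = 0 := by
  ext m; simpa using h m (Nat.zero_le _)

lemma monomial_mem_bivDegreeLT {n a b : ℕ} (h : a + b < n) (c : ℚ) :
    MvPolynomial.monomial (bivExp a b) c ∈ bivDegreeLT n := by
  classical
  intro m hm
  rw [MvPolynomial.coeff_monomial, if_neg]
  rintro rfl
  simp at hm
  omega

/-- A submodule that contains the monomials of degree `< n` contains `bivDegreeLT n`. -/
lemma bivDegreeLT_le {n : ℕ} {S : Submodule ℚ (MvPolynomial (Fin 2) ℚ)}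
    (h : ∀ a b, a + b < n → ∀ c, MvPolynomial.monomial (bivExp a b) c ∈ S) :
    bivDegreeLT n ≤ S := by
  intro P hP
  rw [P.as_sum]
  refine S.sum_mem fun m hm => ?_
  rw [← bivExp_eta m]
  refine h _ _ ?_ _
  by_contra hlt
  exact MvPolynomial.mem_support_iff.mp hm (hP m (not_lt.mp hlt))

lemma X_mul_mem_bivDegreeLT {n : ℕ} (j : Fin 2) {P : MvPolynomial (Fin 2) ℚ}
    (hP : P ∈ bivDegreeLT (n - 1)) : MvPolynomial.X j * P ∈ bivDegreeLT n := by
  classical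
  intro m hm
  rw [MvPolynomial.coeff_X_mul']
  split_ifs with hj
  · apply hP
    rw [Finsupp.mem_support_iff] at hj
    fin_cases j <;> simp at hj ⊢ <;> omega
  · rfl

lemma C_mul_mem_bivDegreeLT {n : ℕ} (c : ℚ) {P : MvPolynomial (Fin 2) ℚ}
    (hP : P ∈ bivDegreeLT n) : MvPolynomial.C c * P ∈ bivDegreeLT n := by
  rw [MvPolynomial.C_mul']
  exact (bivDegreeLT n).smul_mem c hP

/-- The substitution `(u, v) ↦ (u - d, v - 1)`. -/
noncomputable def bivShift (d : ℚ) : MvPolynomial (Fin 2) ℚ →ₐ[ℚ] MvPolynomial (Fin 2) ℚ :=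
  MvPolynomial.aeval fun j => MvPolynomial.X j - MvPolynomial.C (![d, 1] j)

/-- The derivative in the direction `(d, 1)`. -/
noncomputable def bivDeriv (d : ℚ) :
    Derivation ℚ (MvPolynomial (Fin 2) ℚ) (MvPolynomial (Fin 2) ℚ) :=
  d • MvPolynomial.pderiv 0 + MvPolynomial.pderiv 1

lemma bivShift_X (d : ℚ) (j : Fin 2) :
    bivShift d (MvPolynomial.X j) = MvPolynomial.X j - MvPolynomial.C (![d, 1] j) := by
  simp [bivShift]

lemma eval_bivShift (d x y : ℚ) (P : MvPolynomial (Fin 2) ℚ) :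
    MvPolynomial.eval ![x, y] (bivShift d P) = MvPolynomial.eval ![x - d, y - 1] P := by
  induction P using MvPolynomial.induction_on with
  | C a => rw [← MvPolynomial.algebraMap_eq, AlgHom.commutes]; simp [MvPolynomial.algebraMap_eq]
  | add p q hp hq => simp [hp, hq]
  | mul_X p j hp =>
    rw [map_mul, map_mul, hp, map_mul, bivShift_X]
    fin_cases j <;> simp

lemma bivDeriv_X (d : ℚ) (j : Fin 2) :
    bivDeriv d (MvPolynomial.X j) = MvPolynomial.C (![d, 1] j) := by
  fin_cases j <;> simp [bivDeriv, MvPolynomial.pderiv_X, MvPolynomial.smul_eq_C_mul]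

lemma coeff_bivDeriv (d : ℚ) (P : MvPolynomial (Fin 2) ℚ) (i l : ℕ) :
    (bivDeriv d P).coeff (bivExp i l) =
      d * ((i + 1) * P.coeff (bivExp (i + 1) l)) + (l + 1) * P.coeff (bivExp i (l + 1)) := by
  simp only [bivDeriv, Derivation.add_apply, Derivation.smul_apply, MvPolynomial.coeff_add,
    MvPolynomial.coeff_smul, MvPolynomial.coeff_pderiv, bivExp_add_single_zero,
    bivExp_add_single_one, bivExp_zero, bivExp_one, smul_eq_mul]
  ring

/-- Inductive step for comparing difference and derivative: multiplying by a variable changes the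
difference by the Leibniz rule plus a cross term of lower degree. -/
lemma bivShift_sub_X_mul (d : ℚ) (n : ℕ) (j : Fin 2) {P : MvPolynomial (Fin 2) ℚ}
    (h0 : P ∈ bivDegreeLT (n + 1)) (h1 : P - bivShift d P ∈ bivDegreeLT n)
    (h2 : P - bivShift d P - bivDeriv d P ∈ bivDegreeLT (n - 1)) :
    MvPolynomial.X j * P - bivShift d (MvPolynomial.X j * P) ∈ bivDegreeLT (n + 1) ∧
    MvPolynomial.X j * P - bivShift d (MvPolynomial.X j * P) -
      bivDeriv d (MvPolynomial.X j * P) ∈ bivDegreeLT n := by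
  set c : ℚ := ![d, 1] j
  have e1 : MvPolynomial.X j * P - bivShift d (MvPolynomial.X j * P) =
      MvPolynomial.X j * (P - bivShift d P) + MvPolynomial.C c * P -
        MvPolynomial.C c * (P - bivShift d P) := by
    rw [map_mul, bivShift_X]; ring
  have e2 : MvPolynomial.X j * P - bivShift d (MvPolynomial.X j * P) -
      bivDeriv d (MvPolynomial.X j * P) =
      MvPolynomial.X j * (P - bivShift d P - bivDeriv d P) -
        MvPolynomial.C c * (P - bivShift d P) := by
    rw [e1, Derivation.leibniz, bivDeriv_X, smul_eq_mul, smul_eq_mul]; ring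
  refine ⟨?_, ?_⟩
  · rw [e1]
    exact sub_mem (add_mem (X_mul_mem_bivDegreeLT j h1) (C_mul_mem_bivDegreeLT c h0))
      (bivDegreeLT_mono (Nat.le_succ n) (C_mul_mem_bivDegreeLT c h1))
  · rw [e2]
    exact sub_mem (X_mul_mem_bivDegreeLT j h2) (C_mul_mem_bivDegreeLT c h1)

lemma monomial_bivExp_succ_left (a b : ℕ) (c : ℚ) :
    MvPolynomial.monomial (bivExp (a + 1) b) c =
      MvPolynomial.X 0 * MvPolynomial.monomial (bivExp a b) c := by
  rw [MvPolynomial.X, MvPolynomial.monomial_mul, one_mul, ← bivExp_add_single_zero, add_comm]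

lemma monomial_bivExp_succ_right (a b : ℕ) (c : ℚ) :
    MvPolynomial.monomial (bivExp a (b + 1)) c =
      MvPolynomial.X 1 * MvPolynomial.monomial (bivExp a b) c := by
  rw [MvPolynomial.X, MvPolynomial.monomial_mul, one_mul, ← bivExp_add_single_one, add_comm]

lemma monomial_sub_bivShift (d c : ℚ) (a b : ℕ) :
    MvPolynomial.monomial (bivExp a b) c - bivShift d (MvPolynomial.monomial (bivExp a b) c)
      ∈ bivDegreeLT (a + b) ∧
    MvPolynomial.monomial (bivExp a b) c - bivShift d (MvPolynomial.monomial (bivExp a b) c)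
      - bivDeriv d (MvPolynomial.monomial (bivExp a b) c) ∈ bivDegreeLT (a + b - 1) := by
  induction a with
  | zero =>
    induction b with
    | zero =>
      have : MvPolynomial.monomial (bivExp 0 0) c = algebraMap ℚ (MvPolynomial (Fin 2) ℚ) c := by
        simp [bivExp, MvPolynomial.algebraMap_eq]
      rw [this, AlgHom.commutes, Derivation.map_algebraMap]
      simp
    | succ b ih =>
      rw [monomial_bivExp_succ_right, show 0 + (b + 1) = 0 + b + 1 from rfl, Nat.add_sub_cancel]
      exact bivShift_sub_X_mul d _ 1 (monomial_mem_bivDegreeLT (Nat.lt_succ_self _) c) ih.1 ih.2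
  | succ a ih =>
    rw [monomial_bivExp_succ_left, show a + 1 + b = a + b + 1 by omega, Nat.add_sub_cancel]
    exact bivShift_sub_X_mul d _ 0 (monomial_mem_bivDegreeLT (Nat.lt_succ_self _) c) ih.1 ih.2

lemma sub_bivShift_mem (d : ℚ) {n : ℕ} {P : MvPolynomial (Fin 2) ℚ}
    (h : P ∈ bivDegreeLT (n + 1)) : P - bivShift d P ∈ bivDegreeLT n := by
  have : bivDegreeLT (n + 1) ≤
      (bivDegreeLT n).comap (LinearMap.id - (bivShift d).toLinearMap) :=
    bivDegreeLT_le fun a b hab c =>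
      bivDegreeLT_mono (Nat.le_of_lt_succ hab) (monomial_sub_bivShift d c a b).1
  exact this h

lemma sub_bivShift_sub_bivDeriv_mem (d : ℚ) {n : ℕ} {P : MvPolynomial (Fin 2) ℚ}
    (h : P ∈ bivDegreeLT (n + 1)) : P - bivShift d P - bivDeriv d P ∈ bivDegreeLT (n - 1) := by
  have : bivDegreeLT (n + 1) ≤ (bivDegreeLT (n - 1)).comap
      (LinearMap.id - (bivShift d).toLinearMap - (bivDeriv d).toLinearMap) :=
    bivDegreeLT_le fun a b hab c =>
      bivDegreeLT_mono (by omega) (monomial_sub_bivShift d c a b).2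
  exact this h

lemma bivDeriv_monomial (d c : ℚ) (a b : ℕ) :
    bivDeriv d (MvPolynomial.monomial (bivExp a (b + 1)) (c / (b + 1))) =
      MvPolynomial.monomial (bivExp a b) c +
      MvPolynomial.monomial (bivExp (a - 1) (b + 1)) (d * (c / (b + 1) * a)) := by
  have h1 : bivExp a (b + 1) - Finsupp.single 0 1 = bivExp (a - 1) (b + 1) := by
    ext j; fin_cases j <;> simp [bivExp]
  have h2 : bivExp a (b + 1) - Finsupp.single 1 1 = bivExp a b := by
    ext j; fin_cases j <;> simp [bivExp]
  simp only [bivDeriv, Derivation.add_apply, Derivation.smul_apply, MvPolynomial.pderiv_monomial,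
    h1, h2, bivExp_zero, bivExp_one, MvPolynomial.smul_monomial, smul_eq_mul]
  rw [add_comm]
  congr 2
  push_cast
  field_simp

/-- The difference operator `P ↦ P(u, v) - P(u - d, v - 1)` maps polynomials of degree `≤ n` onto
polynomials of degree `< n`. -/
lemma exists_sub_bivShift_eq (d : ℚ) (n : ℕ) :
    bivDegreeLT n ≤ (bivDegreeLT (n + 1)).map (LinearMap.id - (bivShift d).toLinearMap) := by
  induction n with
  | zero => intro P hP; rw [eq_zero_of_mem_bivDegreeLT_zero hP]; exact zero_mem _
  | succ n ih =>
    have ih' : bivDegreeLT n ≤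
        (bivDegreeLT (n + 1 + 1)).map (LinearMap.id - (bivShift d).toLinearMap) :=
      ih.trans (Submodule.map_mono (bivDegreeLT_mono (Nat.le_succ _)))
    -- Up to lower degree, handled by `ih'`, the difference is the derivative in direction (d, 1).
    -- On u^a v^(b+1) / (b+1) this gives u^a v^b plus a multiple of u^(a-1) v^(b+1), so an inner
    -- induction on the exponent of u finishes.
    refine bivDegreeLT_le fun a => ?_
    induction a with
    | zero =>
      intro b hb c
      have hH := monomial_mem_bivDegreeLT (n := n + 1 + 1) (a := 0) (b := b + 1) (by omega)
        (c / (b + 1))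
      have h2 := ih' (sub_bivShift_sub_bivDeriv_mem d hH)
      have h3 := Submodule.mem_map_of_mem (f := LinearMap.id - (bivShift d).toLinearMap) hH
      have h4 := sub_mem h3 h2
      simpa [bivDeriv_monomial] using h4
    | succ a iha =>
      intro b hb c
      have hH := monomial_mem_bivDegreeLT (n := n + 1 + 1) (a := a + 1) (b := b + 1) (by omega)
        (c / (b + 1))
      have h2 := ih' (sub_bivShift_sub_bivDeriv_mem d hH)
      have h3 := Submodule.mem_map_of_mem (f := LinearMap.id - (bivShift d).toLinearMap) hH
      have h4 := sub_mem (sub_mem h3 h2) (iha (b + 1) (by omega) (d * (c / (b + 1) * (a + 1 : ℕ))))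
      simpa [bivDeriv_monomial] using h4

/-- The restriction `P(X, 1)` of a bivariate polynomial to the line `v = 1`. -/
noncomputable def bivRestrict : MvPolynomial (Fin 2) ℚ →ₐ[ℚ] ℚ[X] :=
  MvPolynomial.aeval ![Polynomial.X, 1]

lemma eval_bivRestrict (x : ℚ) (P : MvPolynomial (Fin 2) ℚ) :
    (bivRestrict P).eval x = MvPolynomial.eval ![x, 1] P := by
  induction P using MvPolynomial.induction_on with
  | C a =>
    rw [← MvPolynomial.algebraMap_eq, AlgHom.commutes]
    simp [MvPolynomial.algebraMap_eq, Polynomial.algebraMap_eq]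
  | add p q hp hq => simp [hp, hq]
  | mul_X p j hp =>
    rw [map_mul, Polynomial.eval_mul, map_mul, hp]
    fin_cases j <;> simp [bivRestrict]

lemma bivRestrict_monomial (a b : ℕ) (c : ℚ) :
    bivRestrict (MvPolynomial.monomial (bivExp a b) c) = Polynomial.monomial a c := by
  apply Polynomial.funext
  intro x
  rw [eval_bivRestrict, MvPolynomial.eval_monomial,
    Finsupp.prod_fintype _ _ (fun _ => pow_zero _)]
  simp

lemma bivRestrict_mem_degreeLT {n : ℕ} {P : MvPolynomial (Fin 2) ℚ} (h : P ∈ bivDegreeLT n) :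
    bivRestrict P ∈ Polynomial.degreeLT ℚ n := by
  have : bivDegreeLT n ≤ (Polynomial.degreeLT ℚ n).comap bivRestrict.toLinearMap :=
    bivDegreeLT_le fun a b hab c => by
      rw [Submodule.mem_comap, AlgHom.toLinearMap_apply, bivRestrict_monomial,
        Polynomial.mem_degreeLT]
      exact (Polynomial.degree_monomial_le a c).trans_lt (by exact_mod_cast (by omega : a < n))
  exact this h

lemma coeff_bivRestrict {n : ℕ} {P : MvPolynomial (Fin 2) ℚ} (h : P ∈ bivDegreeLT (n + 1)) :
    (bivRestrict P).coeff n = P.coeff (bivExp n 0) := by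
  classical
  have : bivDegreeLT (n + 1) ≤ LinearMap.ker
      (Polynomial.lcoeff ℚ n ∘ₗ bivRestrict.toLinearMap - MvPolynomial.lcoeff ℚ (bivExp n 0)) :=
    bivDegreeLT_le fun a b hab c => by
      rw [LinearMap.mem_ker, LinearMap.sub_apply, LinearMap.comp_apply, AlgHom.toLinearMap_apply,
        bivRestrict_monomial, Polynomial.lcoeff_apply, Polynomial.coeff_monomial,
        MvPolynomial.lcoeff_apply, MvPolynomial.coeff_monomial, sub_eq_zero]
      have : a = n ↔ bivExp a b = bivExp n 0 := by
        constructor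
        · rintro rfl; congr; omega
        · intro h; simpa using DFunLike.congr_fun h 0
      simp only [this]
  simpa [sub_eq_zero] using this h

/-- The polynomial `κ(u - d v)` of a univariate polynomial `κ`. -/
noncomputable def bivLine (d : ℚ) : ℚ[X] →ₐ[ℚ] MvPolynomial (Fin 2) ℚ :=
  Polynomial.aeval (MvPolynomial.X 0 - MvPolynomial.C d * MvPolynomial.X 1)

lemma bivShift_bivLine (d : ℚ) (κ : ℚ[X]) : bivShift d (bivLine d κ) = bivLine d κ := by
  rw [bivLine, ← Polynomial.aeval_algHom_apply]
  congr 2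
  rw [map_sub, map_mul, bivShift_X, bivShift_X, ← MvPolynomial.algebraMap_eq, AlgHom.commutes]
  simp
  ring

lemma eval_bivLine (d x y : ℚ) (κ : ℚ[X]) :
    MvPolynomial.eval ![x, y] (bivLine d κ) = κ.eval (x - d * y) := by
  induction κ using Polynomial.induction_on' with
  | add p q hp hq => simp [hp, hq]
  | monomial n a => simp [bivLine, Polynomial.aeval_monomial, MvPolynomial.algebraMap_eq]

lemma bivLine_mem {n : ℕ} (d : ℚ) {κ : ℚ[X]} (h : κ ∈ Polynomial.degreeLT ℚ n) :
    bivLine d κ ∈ bivDegreeLT n := by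
  have hpow : ∀ j : ℕ, (MvPolynomial.X 0 - MvPolynomial.C d * MvPolynomial.X 1 :
      MvPolynomial (Fin 2) ℚ) ^ j ∈ bivDegreeLT (j + 1) := by
    intro j
    induction j with
    | zero =>
      have := monomial_mem_bivDegreeLT (n := 1) (a := 0) (b := 0) (by omega) 1
      simpa [bivExp] using this
    | succ j ih =>
      rw [pow_succ', sub_mul, mul_assoc]
      exact sub_mem (X_mul_mem_bivDegreeLT 0 ih)
        (C_mul_mem_bivDegreeLT d (X_mul_mem_bivDegreeLT 1 ih))
  rw [bivLine, Polynomial.aeval_eq_sum_range]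
  refine Submodule.sum_mem _ fun j _ => ?_
  rcases lt_or_ge j n with hj | hj
  · exact Submodule.smul_mem _ _ (bivDegreeLT_mono hj (hpow j))
  · rw [Polynomial.coeff_eq_zero_of_degree_lt
      ((Polynomial.mem_degreeLT.mp h).trans_le (by exact_mod_cast hj)), zero_smul]
    exact zero_mem _

/-- The difference equation `G(u, v) - G(u - d, v - 1) = F(u, v)` with `G(u, 1)` prescribed. -/
lemma exists_bivShift_solution (d : ℚ) {n : ℕ} {F : MvPolynomial (Fin 2) ℚ}
    (hF : F ∈ bivDegreeLT n) {g : ℚ[X]} (hg : g ∈ Polynomial.degreeLT ℚ (n + 1)) :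
    ∃ G ∈ bivDegreeLT (n + 1), G - bivShift d G = F ∧ bivRestrict G = g := by
  obtain ⟨G₀, hG₀, hG₀F⟩ := exists_sub_bivShift_eq d n hF
  -- A polynomial in u - d v is killed by the difference operator. Adding κ(u - d v) therefore
  -- corrects the values at v = 1 freely; the Taylor shift makes κ(x - d) the required correction.
  set κ := Polynomial.taylor d (g - bivRestrict G₀) with hκ
  have hκn : κ ∈ Polynomial.degreeLT ℚ (n + 1) := by
    rw [Polynomial.mem_degreeLT, hκ, Polynomial.degree_taylor, ← Polynomial.mem_degreeLT]
    exact sub_mem hg (bivRestrict_mem_degreeLT hG₀)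
  refine ⟨G₀ + bivLine d κ, add_mem hG₀ (bivLine_mem d hκn), ?_, ?_⟩
  · rw [map_add, bivShift_bivLine, ← hG₀F]
    simp
  · apply Polynomial.funext
    intro x
    rw [map_add, Polynomial.eval_add, eval_bivRestrict, eval_bivRestrict, eval_bivLine, mul_one,
      hκ, Polynomial.taylor_eval_sub, Polynomial.eval_sub, eval_bivRestrict]
    ring

/-- The normalized coefficient of `u^i v^l`. -/
noncomputable def bivSymbol (P : MvPolynomial (Fin 2) ℚ) (i l : ℕ) : ℚ :=
  (i.factorial : ℚ) * (l.factorial : ℚ) * P.coeff (bivExp i l)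

/-- In top degree the difference is d ∂_u + ∂_v, and the factorials in `bivSymbol` absorb the
exponents produced by differentiation. -/
lemma bivSymbol_sub_bivShift (d : ℚ) {n i l : ℕ} {P : MvPolynomial (Fin 2) ℚ}
    (h : P ∈ bivDegreeLT (n + 1)) (hil : i + l + 1 = n) :
    bivSymbol (P - bivShift d P) i l = d * bivSymbol P (i + 1) l + bivSymbol P i (l + 1) := by
  have h1 := sub_bivShift_sub_bivDeriv_mem d h (bivExp i l) (by simp; omega)
  rw [MvPolynomial.coeff_sub, coeff_bivDeriv, sub_eq_zero] at h1
  rw [bivSymbol, h1, bivSymbol, bivSymbol, Nat.factorial_succ, Nat.factorial_succ]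
  push_cast
  ring

/-! ### Complete homogeneous symmetric sums -/

/-- The complete homogeneous symmetric polynomial of degree `n` in the `d l`, `l ∈ s`. -/
noncomputable def completeSum (d : ℕ → ℕ) (s : Finset ℕ) (n : ℕ) : ℚ :=
  ∑ j ∈ Finset.piAntidiag s n, ∏ l ∈ s, (d l : ℚ) ^ j l

lemma completeSum_zero (d : ℕ → ℕ) (s : Finset ℕ) : completeSum d s 0 = 1 := by
  simp [completeSum]

lemma completeSum_empty_succ (d : ℕ → ℕ) (n : ℕ) : completeSum d ∅ (n + 1) = 0 := by
  simp [completeSum]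

lemma completeSum_cons (d : ℕ → ℕ) {i : ℕ} {s : Finset ℕ} (hi : i ∉ s) (n : ℕ) :
    completeSum d (Finset.cons i s hi) n =
      ∑ p ∈ Finset.HasAntidiagonal.antidiagonal n, (d i : ℚ) ^ p.1 * completeSum d s p.2 := by
  rw [completeSum, Finset.piAntidiag_cons, Finset.sum_disjiUnion]
  refine Finset.sum_congr rfl fun p _ => ?_
  rw [Finset.sum_map, completeSum, Finset.mul_sum]
  refine Finset.sum_congr rfl fun j hj => ?_
  have hji : j i = 0 := by
    by_contra h
    exact hi ((Finset.mem_piAntidiag.mp hj).2 i h)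
  rw [Finset.prod_cons]
  congr 1
  · simp [hji]
  · refine Finset.prod_congr rfl fun l hl => ?_
    have : l ≠ i := fun h => hi (h ▸ hl)
    simp [this]

/-- Monomials are split according to whether they involve the variable d i. -/
lemma completeSum_cons_succ (d : ℕ → ℕ) {i : ℕ} {s : Finset ℕ} (hi : i ∉ s) (n : ℕ) :
    completeSum d (Finset.cons i s hi) (n + 1) =
      completeSum d s (n + 1) + d i * completeSum d (Finset.cons i s hi) n := by
  rw [completeSum_cons, completeSum_cons, Finset.Nat.sum_antidiagonal_succ, Finset.mul_sum]
  simp [pow_succ', mul_assoc]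

lemma completeSum_Icc_succ (d : ℕ → ℕ) {a b : ℕ} (h : a ≤ b) (n : ℕ) :
    completeSum d (Finset.Icc a b) (n + 1) =
      completeSum d (Finset.Icc (a + 1) b) (n + 1) + d a * completeSum d (Finset.Icc a b) n := by
  have : Finset.Icc a b = Finset.cons a (Finset.Icc (a + 1) b) (by simp) := by
    ext x; simp; omega
  rw [this]
  exact completeSum_cons_succ d _ n

/-- The signed sums of the coefficients `e q`, `q > i`, which solve the recursion of normalized
coefficients. -/
noncomputable def mixedSum (d : ℕ → ℕ) (e : ℕ → ℚ) (i l : ℕ) : ℚ :=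
  ∑ c ∈ Finset.range (l + 1),
    (-1) ^ (l - c) * e (i + 1 + c) * completeSum d (Finset.Icc (i + 1) (i + 1 + c)) (l - c)

lemma mixedSum_zero (d : ℕ → ℕ) (e : ℕ → ℚ) (i : ℕ) : mixedSum d e i 0 = e (i + 1) := by
  simp [mixedSum, completeSum_zero]

/-- This is the recursion of `bivSymbol_sub_bivShift` solved for the coefficient with the larger
power of v; `mixedSum_zero` gives its initial value. -/
lemma mixedSum_succ (d : ℕ → ℕ) (e : ℕ → ℚ) (i l : ℕ) :
    mixedSum d e i (l + 1) = mixedSum d e (i + 1) l - d (i + 1) * mixedSum d e i l := by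
  have h0 : completeSum d (Finset.Icc (i + 1) (i + 1 + 0)) (l + 1) =
      d (i + 1) * completeSum d (Finset.Icc (i + 1) (i + 1 + 0)) l := by
    rw [completeSum_Icc_succ d (by omega), Finset.Icc_eq_empty (by omega), completeSum_empty_succ,
      zero_add]
  have hc : ∀ c ∈ Finset.range l,
      (-1 : ℚ) ^ (l + 1 - (c + 1)) * e (i + 1 + (c + 1)) *
        completeSum d (Finset.Icc (i + 1) (i + 1 + (c + 1))) (l + 1 - (c + 1)) =
      (-1) ^ (l - c) * e (i + 1 + 1 + c) *
        completeSum d (Finset.Icc (i + 1 + 1) (i + 1 + 1 + c)) (l - c) -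
      d (i + 1) * ((-1) ^ (l - (c + 1)) * e (i + 1 + (c + 1)) *
        completeSum d (Finset.Icc (i + 1) (i + 1 + (c + 1))) (l - (c + 1))) := by
    intro c hc
    obtain ⟨n, hn⟩ : ∃ n, l - c = n + 1 :=
      ⟨l - c - 1, by have := Finset.mem_range.mp hc; omega⟩
    rw [show l + 1 - (c + 1) = n + 1 by omega, show l - (c + 1) = n by omega, hn,
      completeSum_Icc_succ d (by omega), show i + 1 + (c + 1) = i + 1 + 1 + c by ring, pow_succ]
    ring
  rw [mixedSum, Finset.sum_range_succ', Finset.sum_range_succ, Finset.sum_congr rfl hc,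
    Finset.sum_sub_distrib, mixedSum, Finset.sum_range_succ, mixedSum, Finset.sum_range_succ',
    ← Finset.mul_sum, Nat.sub_zero, Nat.sub_zero, h0, show i + 1 + (l + 1) = i + 1 + 1 + l by ring,
    Nat.sub_self, Nat.sub_self, completeSum_zero, completeSum_zero, pow_succ]
  ring

/-- Polynomial solution of the recursion satisfied by the Hilbert functions of the modules
`I^v / (f_1, …, f_i) I^(v-1)`. -/
theorem exists_bivariate_of_recursion (r D c u₀ : ℕ) (d : ℕ → ℕ)
    (hdc : ∀ q ∈ Set.Icc 1 r, d q ≤ c) (h : ℕ → ℕ → ℕ → ℚ) (p : ℕ → ℚ[X])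
    (hr : ∀ u v, 1 ≤ v → h r v u = 0)
    (h_one : ∀ i < r, ∀ u, c + u₀ ≤ u →
      h i 1 u = h (i + 1) 1 u + (p (i + 1)).eval ((u : ℚ) - d (i + 1)))
    (h_succ : ∀ i < r, ∀ v, 1 ≤ v → ∀ u, c * (v + 1) + u₀ ≤ u →
      h i (v + 1) u = h (i + 1) (v + 1) u + h i v (u - d (i + 1)))
    (hp : ∀ q ∈ Set.Icc 1 r, p q ∈ Polynomial.degreeLT ℚ (D + 1 - q))
    (e : ℕ → ℚ) (he : ∀ q ∈ Set.Icc 1 r, e q = ((D - q).factorial : ℚ) * (p q).coeff (D - q))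
    (he' : ∀ q, r < q → e q = 0) (i : ℕ) (hi : i ≤ r) :
    ∃ Q ∈ bivDegreeLT (D - i),
      (∀ u v : ℕ, 1 ≤ v → c * v + u₀ ≤ u →
        h i v u = MvPolynomial.eval ![(u : ℚ), (v : ℚ)] Q) ∧
      ∀ j l : ℕ, j + l + 1 = D - i → bivSymbol Q j l = mixedSum d e i l := by
  induction hi using Nat.decreasingInduction with
  | self =>
    refine ⟨0, zero_mem _, fun u v hv _ => by simp [hr u v hv], fun j l _ => ?_⟩
    rw [mixedSum, Finset.sum_eq_zero]
    · simp [bivSymbol]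
    · intro c _
      rw [he' _ (by omega)]
      ring
  | of_succ i hi ih =>
    obtain ⟨F, hF, hFh, hFs⟩ := ih
    have hq : i + 1 ∈ Set.Icc 1 r := ⟨by omega, hi⟩
    set δ : ℚ := (d (i + 1) : ℚ) with hδ
    set g : ℚ[X] := bivRestrict F + Polynomial.taylor (-δ) (p (i + 1)) with hg
    have hp' : Polynomial.taylor (-δ) (p (i + 1)) ∈ Polynomial.degreeLT ℚ (D - i) := by
      rw [Polynomial.mem_degreeLT, Polynomial.degree_taylor, ← Polynomial.mem_degreeLT]
      have := hp _ hq
      rwa [Nat.add_sub_add_right] at this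
    have hF' := bivRestrict_mem_degreeLT hF
    have hmono : Polynomial.degreeLT ℚ (D - (i + 1)) ≤ Polynomial.degreeLT ℚ (D - i) :=
      Polynomial.degreeLT_mono (by omega)
    have hgD : g ∈ Polynomial.degreeLT ℚ (D - i) := add_mem (hmono hF') hp'
    obtain ⟨G, hG, hGF, hGg⟩ : ∃ G ∈ bivDegreeLT (D - i), G - bivShift δ G = F ∧
        bivRestrict G = g := by
      -- When D ≤ i the degree bounds force all data to vanish, and the truncated subtraction must
      -- not be read as a degree drop by one.
      rcases Nat.eq_zero_or_pos (D - i) with h0 | h0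
      · have hF0 : F = 0 := eq_zero_of_mem_bivDegreeLT_zero (bivDegreeLT_mono (by omega) hF)
        have hg0 : g = 0 := by
          rw [h0, Polynomial.mem_degreeLT] at hgD
          simpa using hgD
        exact ⟨0, zero_mem _, by simp [hF0], by simp [hg0]⟩
      · have h1 : D - i = D - (i + 1) + 1 := by omega
        rw [h1] at hgD ⊢
        exact exists_bivShift_solution δ hF hgD
    refine ⟨G, hG, ?_, ?_⟩
    · intro u v hv
      induction v, hv using Nat.le_induction generalizing u with
      | base =>
        intro hu
        rw [mul_one] at hu
        rw [h_one i hi u hu, hFh u 1 le_rfl (by omega)]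
        have := eval_bivRestrict u G
        rw [hGg, hg, Polynomial.eval_add, eval_bivRestrict, Polynomial.taylor_eval,
          ← sub_eq_add_neg] at this
        rw [Nat.cast_one, ← this]
      | succ v hv ihv =>
        intro hu
        have hd := hdc _ hq
        -- As d (i + 1) ≤ c, the region u ≥ c v + u₀ is stable under (u, v) ↦ (u - d (i + 1), v -
        -- 1), so the induction hypothesis applies.
        have hu' : c * v + u₀ + d (i + 1) ≤ u := by
          rw [mul_add, mul_one] at hu; omega
        rw [h_succ i hi v hv u hu, hFh u (v + 1) (by omega) hu, ihv (u - d (i + 1)) (by omega),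
          ← hGF, map_sub, eval_bivShift, Nat.cast_sub (by omega)]
        push_cast
        rw [add_sub_cancel_right]
        ring
    · intro j l
      induction l generalizing j with
      | zero =>
        intro hjl
        have hj : D - i = j + 1 := by omega
        -- The pure power of u is visible on the line v = 1. There F has too small a degree to
        -- contribute, and translation does not change the top coefficient of `p (i + 1)`.
        rw [mixedSum_zero, he _ hq, bivSymbol, ← coeff_bivRestrict (hj ▸ hG), hGg, hg,
          Polynomial.coeff_add, Polynomial.coeff_eq_zero_of_degree_lt (p := bivRestrict F)]
        · have h1 : D - (i + 1) = j := by omega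
          have h2 : (Polynomial.taylor (-δ) (p (i + 1))).coeff j = (p (i + 1)).coeff j := by
            have hdeg := hp _ hq
            rw [Nat.add_sub_add_right, hj, Polynomial.mem_degreeLT] at hdeg
            rcases eq_or_ne (p (i + 1)).natDegree j with he | hne
            · rw [← he, Polynomial.coeff_taylor_natDegree]; rfl
            · have hlt : (p (i + 1)).degree < j := by
                rcases eq_or_ne (p (i + 1)) 0 with h0 | h0
                · rw [h0, Polynomial.degree_zero]; exact WithBot.bot_lt_coe _
                · rw [Polynomial.degree_eq_natDegree h0] at hdeg ⊢
                  norm_cast at hdeg ⊢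
                  omega
              rw [Polynomial.coeff_eq_zero_of_degree_lt hlt,
                Polynomial.coeff_eq_zero_of_degree_lt (by rwa [Polynomial.degree_taylor])]
          rw [h1, h2]
          simp
        · have := Polynomial.mem_degreeLT.mp hF'
          rwa [show D - (i + 1) = j by omega] at this
      | succ l ihl =>
        intro hjl
        have h1 : D - i = (j + l + 1) + 1 := by omega
        have h2 := bivSymbol_sub_bivShift δ (h1 ▸ hG) (rfl : j + l + 1 = j + l + 1)
        rw [hGF, hFs j l (by omega), ihl (j + 1) (by omega)] at h2
        rw [mixedSum_succ]
        linarith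

/-! ### Univariate polynomials -/

/-- The restriction `P(X, X)` of a bivariate polynomial to the diagonal. -/
noncomputable def bivDiag : MvPolynomial (Fin 2) ℚ →ₐ[ℚ] ℚ[X] :=
  MvPolynomial.aeval fun _ => Polynomial.X

lemma eval_bivDiag (x : ℚ) (P : MvPolynomial (Fin 2) ℚ) :
    (bivDiag P).eval x = MvPolynomial.eval ![x, x] P := by
  induction P using MvPolynomial.induction_on with
  | C a =>
    rw [← MvPolynomial.algebraMap_eq, AlgHom.commutes]
    simp [MvPolynomial.algebraMap_eq, Polynomial.algebraMap_eq]
  | add p q hp hq => simp [hp, hq]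
  | mul_X p j hp =>
    rw [map_mul, Polynomial.eval_mul, map_mul, hp]
    fin_cases j <;> simp [bivDiag]

lemma bivDiag_mem_degreeLT {n : ℕ} {P : MvPolynomial (Fin 2) ℚ} (h : P ∈ bivDegreeLT n) :
    bivDiag P ∈ Polynomial.degreeLT ℚ n := by
  have : bivDegreeLT n ≤ (Polynomial.degreeLT ℚ n).comap bivDiag.toLinearMap :=
    bivDegreeLT_le fun a b hab c => by
      have h1 : bivDiag (MvPolynomial.monomial (bivExp a b) c) =
          Polynomial.monomial (a + b) c := by
        apply Polynomial.funext
        intro x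
        rw [eval_bivDiag, MvPolynomial.eval_monomial,
          Finsupp.prod_fintype _ _ (fun _ => pow_zero _)]
        simp [pow_add]
      rw [Submodule.mem_comap, AlgHom.toLinearMap_apply, h1, Polynomial.mem_degreeLT]
      exact (Polynomial.degree_monomial_le _ c).trans_lt (by exact_mod_cast hab)
  exact this h

/-- Polynomials have discrete antiderivatives. -/
lemma exists_eval_sub_eval_eq {n : ℕ} {p : ℚ[X]} (hp : p ∈ Polynomial.degreeLT ℚ n) :
    ∃ q ∈ Polynomial.degreeLT ℚ (n + 1), ∀ y, q.eval y - q.eval (y - 1) = p.eval y := by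
  -- The direction (1, 1) runs along the diagonal, so a bivariate solution for p(u) restricts there
  -- to a discrete antiderivative.
  obtain ⟨G, hG, hGp⟩ := exists_sub_bivShift_eq 1 n (bivLine_mem 0 hp)
  refine ⟨bivDiag G, bivDiag_mem_degreeLT hG, fun y => ?_⟩
  have := congrArg (MvPolynomial.eval ![y, y]) hGp
  rw [eval_bivLine] at this
  rw [eval_bivDiag, eval_bivDiag, ← eval_bivShift, ← map_sub]
  simpa using this

/-- Backward differences lower the degree. -/
lemma sub_taylor_mem_degreeLT {n : ℕ} {q : ℚ[X]} (hq : q ∈ Polynomial.degreeLT ℚ (n + 1)) :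
    q - Polynomial.taylor (-1) q ∈ Polynomial.degreeLT ℚ n := by
  have h := bivRestrict_mem_degreeLT (sub_bivShift_mem 1 (bivLine_mem 0 hq))
  convert h using 1
  apply Polynomial.funext
  intro y
  rw [map_sub, Polynomial.eval_sub, Polynomial.eval_sub, eval_bivRestrict, eval_bivRestrict,
    eval_bivShift, eval_bivLine, eval_bivLine, Polynomial.taylor_eval]
  simp [sub_eq_add_neg]

/-! ### Graded pieces of ideals -/

lemma finrank_map_add_finrank_inf_ker {k V W : Type*} [Field k] [AddCommGroup V] [Module k V]
    [AddCommGroup W] [Module k W] (L : V →ₗ[k] W) (S : Submodule k V) [FiniteDimensional k S] :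
    Module.finrank k (S.map L) + Module.finrank k (S ⊓ LinearMap.ker L : Submodule k V) =
      Module.finrank k S := by
  rw [← LinearMap.finrank_range_add_finrank_ker (L.domRestrict S), LinearMap.range_domRestrict]
  congr 1
  rw [LinearMap.ker_domRestrict, ← Submodule.finrank_map_subtype_eq, Submodule.map_comap_subtype]

section Graded

variable {k A : Type*} [Field k] [CommRing A] [Algebra k A] (𝒜 : ℕ → Submodule k A)

/-- The piece of degree `u` of an ideal. -/
def gradedPart (J : Ideal A) (u : ℕ) : Submodule k A := 𝒜 u ⊓ J.restrictScalars k

variable {𝒜}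

lemma mem_gradedPart {J : Ideal A} {u : ℕ} {x : A} : x ∈ gradedPart 𝒜 J u ↔ x ∈ 𝒜 u ∧ x ∈ J :=
  Iff.rfl

lemma gradedPart_mono {J K : Ideal A} (h : J ≤ K) (u : ℕ) : gradedPart 𝒜 J u ≤ gradedPart 𝒜 K u :=
  fun _ hx => ⟨hx.1, h hx.2⟩

lemma IsStandardGraded.finiteType (hA : IsStandardGraded 𝒜) : Algebra.FiniteType k A := by
  obtain ⟨s, hs⟩ := Module.Finite.iff_fg.mp hA.finite_one
  refine ⟨⟨s, ?_⟩⟩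
  rw [← Algebra.adjoin_span, hs, hA.adjoin_one]

lemma IsStandardGraded.isNoetherianRing (hA : IsStandardGraded 𝒜) : IsNoetherianRing A := by
  have := hA.finiteType
  exact Algebra.FiniteType.isNoetherianRing k A

variable [GradedAlgebra 𝒜]

lemma IsStandardGraded.le_pow (hA : IsStandardGraded 𝒜) (u : ℕ) : 𝒜 u ≤ 𝒜 1 ^ u := by
  have key : ∀ x : A, ∀ u, (DirectSum.decompose 𝒜 x u : A) ∈ 𝒜 1 ^ u := by
    intro x
    have hx : x ∈ Algebra.adjoin k (𝒜 1 : Set A) := by rw [hA.adjoin_one]; trivial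
    induction hx using Algebra.adjoin_induction with
    | mem x hx =>
      intro u
      rcases eq_or_ne 1 u with rfl | hu
      · rw [DirectSum.decompose_of_mem_same 𝒜 hx, pow_one]; exact hx
      · rw [DirectSum.decompose_of_mem_ne 𝒜 hx hu]; exact zero_mem _
    | algebraMap r =>
      intro u
      have hx : algebraMap k A r ∈ 𝒜 0 := SetLike.algebraMap_mem_graded 𝒜 r
      rcases eq_or_ne 0 u with rfl | hu
      · rw [DirectSum.decompose_of_mem_same 𝒜 hx, pow_zero]
        exact Submodule.algebraMap_mem r
      · rw [DirectSum.decompose_of_mem_ne 𝒜 hx hu]; exact zero_mem _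
    | add x y _ _ hx hy =>
      intro u
      rw [DirectSum.decompose_add, DirectSum.add_apply, Submodule.coe_add]
      exact add_mem (hx u) (hy u)
    | mul x y _ _ hx hy =>
      intro u
      rw [DirectSum.decompose_mul, DirectSum.coe_mul_apply_eq_sum_antidiagonal]
      refine Submodule.sum_mem _ fun p hp => ?_
      rw [← Finset.HasAntidiagonal.mem_antidiagonal.mp hp, pow_add]
      exact Submodule.mul_mem_mul (hx _) (hy _)
  intro x hx
  have := key x u
  rwa [DirectSum.decompose_of_mem_same 𝒜 hx] at this

lemma IsStandardGraded.finiteDimensional (hA : IsStandardGraded 𝒜) (u : ℕ) :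
    FiniteDimensional k (𝒜 u) := by
  have h1 : (𝒜 1).FG := Module.Finite.iff_fg.mp hA.finite_one
  have : FiniteDimensional k (𝒜 1 ^ u : Submodule k A) := Module.Finite.iff_fg.mpr (h1.pow u)
  exact Submodule.finiteDimensional_of_le (hA.le_pow u)

lemma IsStandardGraded.finiteDimensional_gradedPart (hA : IsStandardGraded 𝒜) (J : Ideal A)
    (u : ℕ) : FiniteDimensional k (gradedPart 𝒜 J u) := by
  have := hA.finiteDimensional u
  exact Submodule.finiteDimensional_of_le inf_le_left

lemma Ideal.IsHomogeneous.colon {J : Ideal A} (hJ : J.IsHomogeneous 𝒜) {f : A} {d : ℕ}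
    (hf : f ∈ 𝒜 d) : (J.colon {f}).IsHomogeneous 𝒜 := by
  intro i x hx
  rw [Submodule.mem_colon_singleton, smul_eq_mul] at hx ⊢
  rw [← DirectSum.coe_decompose_mul_add_of_right_mem 𝒜 hf]
  exact hJ _ hx

/-- Multiplication by a homogeneous `f` maps `M` onto `(N + f M) / N` with kernel `M ∩ (N : f)`. -/
lemma IsStandardGraded.finrank_sup_mul (hA : IsStandardGraded 𝒜) {M N : Ideal A}
    (hM : M.IsHomogeneous 𝒜) (hN : N.IsHomogeneous 𝒜) {f : A} {d : ℕ} (hf : f ∈ 𝒜 d) (w : ℕ) :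
    Module.finrank k (gradedPart 𝒜 (N ⊔ Ideal.span {f} * M) (w + d)) +
      Module.finrank k (gradedPart 𝒜 (M ⊓ N.colon {f}) w) =
    Module.finrank k (gradedPart 𝒜 N (w + d)) + Module.finrank k (gradedPart 𝒜 M w) := by
  have := hA.finiteDimensional_gradedPart M w
  have := hA.finiteDimensional_gradedPart (N ⊔ Ideal.span {f} * M) (w + d)
  set L₂ := (gradedPart 𝒜 N (w + d)).mkQ
  set L₁ := L₂ ∘ₗ LinearMap.mulLeft k f
  have h1 := finrank_map_add_finrank_inf_ker L₁ (gradedPart 𝒜 M w)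
  have h2 := finrank_map_add_finrank_inf_ker L₂ (gradedPart 𝒜 (N ⊔ Ideal.span {f} * M) (w + d))
  have e1 : gradedPart 𝒜 M w ⊓ LinearMap.ker L₁ = gradedPart 𝒜 (M ⊓ N.colon {f}) w := by
    ext x
    simp only [Submodule.mem_inf, LinearMap.mem_ker, L₁, L₂, LinearMap.comp_apply,
      Submodule.mkQ_apply, Submodule.Quotient.mk_eq_zero, mem_gradedPart, LinearMap.mulLeft_apply,
      Submodule.mem_colon_singleton, smul_eq_mul, mul_comm x f]
    constructor
    · rintro ⟨⟨h, h'⟩, -, h''⟩; exact ⟨h, h', h''⟩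
    · rintro ⟨h, h', h''⟩
      exact ⟨⟨h, h'⟩, by rw [mul_comm]; exact SetLike.mul_mem_graded h hf, h''⟩
  have e2 : gradedPart 𝒜 (N ⊔ Ideal.span {f} * M) (w + d) ⊓ LinearMap.ker L₂ =
      gradedPart 𝒜 N (w + d) := by
    rw [Submodule.ker_mkQ]
    exact inf_eq_right.mpr (gradedPart_mono le_sup_left _)
  -- By homogeneity the relevant components of a and y again lie in M and N, so modulo N every
  -- element of degree w + d comes from f times an element of M of degree w.
  have e3 : (gradedPart 𝒜 M w).map L₁ =
      (gradedPart 𝒜 (N ⊔ Ideal.span {f} * M) (w + d)).map L₂ := by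
    apply le_antisymm
    · rintro _ ⟨x, hx, rfl⟩
      refine ⟨f * x, ⟨by rw [mul_comm]; exact SetLike.mul_mem_graded hx.1 hf, ?_⟩, rfl⟩
      exact Ideal.mem_sup_right (Ideal.mul_mem_mul (Ideal.mem_span_singleton_self f) hx.2)
    · rintro _ ⟨z, ⟨hz, hz'⟩, rfl⟩
      obtain ⟨y, hy, b, hb, hyb⟩ := Submodule.mem_sup.mp hz'
      obtain ⟨a, ha, rfl⟩ := Ideal.mem_span_singleton_mul.mp hb
      refine ⟨DirectSum.decompose 𝒜 a w, ⟨SetLike.coe_mem _, hM _ ha⟩, ?_⟩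
      have h3 : (DirectSum.decompose 𝒜 (f * a) (w + d) : A) = f * DirectSum.decompose 𝒜 a w := by
        rw [mul_comm, DirectSum.coe_decompose_mul_add_of_right_mem 𝒜 hf, mul_comm]
      have h4 : (DirectSum.decompose 𝒜 y (w + d) : A) + f * DirectSum.decompose 𝒜 a w = z := by
        rw [← h3, ← Submodule.coe_add, ← DirectSum.add_apply, ← DirectSum.decompose_add, hyb,
          DirectSum.decompose_of_mem_same 𝒜 hz]
      change L₂ (f * DirectSum.decompose 𝒜 a w) = L₂ z
      rw [← h4, map_add, eq_comm, add_eq_right]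
      exact (Submodule.Quotient.mk_eq_zero _).mpr ⟨SetLike.coe_mem _, hN _ hy⟩
  rw [e1, e3] at h1
  rw [e2] at h2
  omega

lemma IsStandardGraded.quotientHilbertFun_add (hA : IsStandardGraded 𝒜) (J : Ideal A) (u : ℕ) :
    quotientHilbertFun 𝒜 J u + Module.finrank k (gradedPart 𝒜 J u) = Module.finrank k (𝒜 u) := by
  have := hA.finiteDimensional u
  rw [← finrank_map_add_finrank_inf_ker (Ideal.Quotient.mkₐ k J).toLinearMap (𝒜 u)]
  have : gradedPart 𝒜 J u = 𝒜 u ⊓ LinearMap.ker (Ideal.Quotient.mkₐ k J).toLinearMap := by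
    ext x
    simp [gradedPart, Ideal.Quotient.eq_zero_iff_mem]
  rw [this]
  rfl

/-- Dimension count for 0 → (A/(J : f))(-d) → A/J → A/(J + (f)) → 0. -/
lemma IsStandardGraded.quotientHilbertFun_exact (hA : IsStandardGraded 𝒜) {J : Ideal A}
    (hJ : J.IsHomogeneous 𝒜) {f : A} {d : ℕ} (hf : f ∈ 𝒜 d) (w : ℕ) :
    quotientHilbertFun 𝒜 J (w + d) = quotientHilbertFun 𝒜 (J ⊔ Ideal.span {f}) (w + d) +
      quotientHilbertFun 𝒜 (J.colon {f}) w := by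
  have h := hA.finrank_sup_mul (Ideal.IsHomogeneous.top 𝒜) hJ hf w
  rw [Ideal.mul_top, top_inf_eq] at h
  have h1 := hA.quotientHilbertFun_add J (w + d)
  have h2 := hA.quotientHilbertFun_add (J ⊔ Ideal.span {f}) (w + d)
  have h3 := hA.quotientHilbertFun_add (J.colon {f}) w
  have h4 : gradedPart 𝒜 (⊤ : Ideal A) w = 𝒜 w := by
    ext x; simp [mem_gradedPart]
  rw [h4] at h
  omega

lemma IsStandardGraded.quotientHilbertFun_eq_zero (hA : IsStandardGraded 𝒜) {J : Ideal A}
    (hJ : (𝒜 1 : Set A) ⊆ J) {u : ℕ} (hu : u ≠ 0) : quotientHilbertFun 𝒜 J u = 0 := by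
  obtain ⟨u, rfl⟩ := Nat.exists_eq_succ_of_ne_zero hu
  have hle : 𝒜 (u + 1) ≤ J.restrictScalars k := by
    refine (hA.le_pow _).trans ?_
    rw [pow_succ', Submodule.mul_le]
    intro x hx y _
    exact J.mul_mem_right y (hJ hx)
  have h0 : (𝒜 (u + 1)).map (Ideal.Quotient.mkₐ k J).toLinearMap = ⊥ := by
    rw [Submodule.eq_bot_iff]
    rintro _ ⟨x, hx, rfl⟩
    exact Ideal.Quotient.eq_zero_iff_mem.mpr (hle hx)
  rw [quotientHilbertFun, h0, finrank_bot]

lemma exists_isHilbertPolynomial_of_sub {H H' : ℕ → ℕ} {p : ℚ[X]} (hp : IsHilbertPolynomial H' p)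
    (h : ∀ w, H (w + 1) = H' (w + 1) + H w) : ∃ q, IsHilbertPolynomial H q := by
  obtain ⟨u₀, hu⟩ := hp
  obtain ⟨q, -, hq⟩ := exists_eval_sub_eval_eq (n := p.natDegree + 1)
    (Polynomial.mem_degreeLT.mpr (Polynomial.degree_le_natDegree.trans_lt
      (by exact_mod_cast Nat.lt_succ_self _)))
  refine ⟨q + Polynomial.C ((H u₀ : ℚ) - q.eval (u₀ : ℚ)), u₀, fun u huu => ?_⟩
  induction u, huu using Nat.le_induction with
  | base => simp
  | succ u huu ih =>
    have h1 := hq ((u + 1 : ℕ) : ℚ)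
    rw [← hu (u + 1) (by omega)] at h1
    rw [h, Nat.cast_add, ih, ← h1]
    push_cast
    simp only [add_sub_cancel_right, Polynomial.eval_add, Polynomial.eval_C]
    ring

/-- Existence of Hilbert polynomials. -/
theorem IsStandardGraded.exists_isHilbertPolynomial (hA : IsStandardGraded 𝒜) (J : Ideal A)
    (hJ : J.IsHomogeneous 𝒜) : ∃ p, IsHilbertPolynomial (quotientHilbertFun 𝒜 J) p := by
  have := hA.isNoetherianRing
  induction J using IsNoetherian.induction with
  | hgt J ih =>
  by_cases h1 : (𝒜 1 : Set A) ⊆ J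
  · refine ⟨0, 1, fun u hu => ?_⟩
    rw [hA.quotientHilbertFun_eq_zero h1 (by omega)]
    simp
  obtain ⟨x, hx, hxJ⟩ := Set.not_subset.mp h1
  obtain ⟨p₁, hp₁⟩ := ih (J ⊔ Ideal.span {x})
    (lt_of_le_of_ne le_sup_left fun h => hxJ (by
      rw [h]; exact Ideal.mem_sup_right (Ideal.mem_span_singleton_self x)))
    (hJ.sup (Ideal.homogeneous_span 𝒜 _ (by rintro y rfl; exact ⟨1, hx⟩)))
  have hex := fun w => hA.quotientHilbertFun_exact hJ hx w
  -- If x is a nonzerodivisor modulo J, the Hilbert function is a discrete antiderivative of a known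
  -- one; otherwise both outer terms fall under Noetherian induction.
  rcases (Ideal.le_colon : J ≤ J.colon {x}).eq_or_lt with he | hlt
  · rw [← he] at hex
    exact exists_isHilbertPolynomial_of_sub hp₁ hex
  · obtain ⟨p₂, hp₂⟩ := ih _ hlt (hJ.colon hx)
    obtain ⟨u₁, hu₁⟩ := hp₁
    obtain ⟨u₂, hu₂⟩ := hp₂
    refine ⟨p₁ + p₂.comp (Polynomial.X - 1), u₁ + u₂ + 1, fun u hu => ?_⟩
    obtain ⟨w, rfl⟩ : ∃ w, u = w + 1 := ⟨u - 1, by omega⟩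
    rw [hex, Nat.cast_add, hu₁ _ (by omega), hu₂ _ (by omega)]
    simp

end Graded

/-! ### Krull dimension and growth -/

/-- Lying over and going up lift chains of primes; incomparability keeps contracted chains strict.
-/
lemma ringKrullDim_eq_of_isIntegral {R S : Type*} [CommRing R] [CommRing S] [Algebra R S]
    [Algebra.IsIntegral R S] (hinj : Function.Injective (algebraMap R S)) :
    ringKrullDim R = ringKrullDim S := by
  apply le_antisymm
  · refine iSup_le fun l => ?_
    have : FaithfulSMul R S := (faithfulSMul_iff_algebraMap_injective R S).mpr hinj
    obtain ⟨⟨Q, hQ, hQl⟩⟩ := Ideal.nonempty_primesOver (S := S) l.head.asIdeal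
    obtain ⟨L, hL, -⟩ := Ideal.exists_ltSeries_of_hasGoingUp l Q
    rw [← hL]
    exact Order.LTSeries.length_le_krullDim L
  · refine Order.krullDim_le_of_strictMono (PrimeSpectrum.comap (algebraMap R S)) ?_
    intro P Q hPQ
    exact Ideal.IsIntegral.comap_lt_comap (show P.asIdeal < Q.asIdeal from hPQ)

section Growth

variable {k : Type*} [Field k]

lemma restrictDegree_eq_span (n M : ℕ) :
    MvPolynomial.restrictDegree (Fin n) k M = Submodule.span k (Set.range
      fun a : Fin n → Fin (M + 1) =>
        MvPolynomial.monomial (Finsupp.equivFunOnFinite.symm fun i => (a i : ℕ)) (1 : k)) := by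
  apply le_antisymm
  · intro p hp
    rw [MvPolynomial.mem_restrictDegree] at hp
    rw [p.as_sum]
    refine Submodule.sum_mem _ fun m hm => ?_
    rw [← mul_one (MvPolynomial.coeff m p), ← smul_eq_mul, ← MvPolynomial.smul_monomial]
    refine Submodule.smul_mem _ _ (Submodule.subset_span ⟨fun i => ⟨m i, ?_⟩, ?_⟩)
    · have := hp m hm i; omega
    · ext i; simp
  · rw [Submodule.span_le]
    rintro _ ⟨a, rfl⟩
    rw [SetLike.mem_coe, MvPolynomial.mem_restrictDegree]
    intro s hs i
    have := MvPolynomial.support_monomial_subset hs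
    rw [Finset.mem_singleton] at this
    subst this
    simpa using Nat.lt_succ_iff.mp (a i).2

/-- Bounding each exponent separately, rather than the total degree, makes the count an exact power.
-/
lemma finrank_restrictDegree (n M : ℕ) :
    Module.finrank k (MvPolynomial.restrictDegree (Fin n) k M) = (M + 1) ^ n := by
  rw [restrictDegree_eq_span, finrank_span_eq_card]
  · simp
  · refine (MvPolynomial.basisMonomials (Fin n) k).linearIndependent.comp
      (fun a : Fin n → Fin (M + 1) => Finsupp.equivFunOnFinite.symm fun i => (a i : ℕ)) ?_
    intro a b h
    ext i
    simpa using DFunLike.congr_fun h i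

lemma mul_mem_restrictDegree {n a b : ℕ} {p q : MvPolynomial (Fin n) k}
    (hp : p ∈ MvPolynomial.restrictDegree (Fin n) k a)
    (hq : q ∈ MvPolynomial.restrictDegree (Fin n) k b) :
    p * q ∈ MvPolynomial.restrictDegree (Fin n) k (a + b) := by
  classical
  rw [MvPolynomial.mem_restrictDegree] at *
  intro s hs i
  obtain ⟨s₁, h₁, s₂, h₂, rfl⟩ := Finset.mem_add.mp (MvPolynomial.support_mul p q hs)
  rw [Finsupp.add_apply]
  exact add_le_add (hp _ h₁ i) (hq _ h₂ i)

lemma exists_mem_restrictDegree {n : ℕ} (p : MvPolynomial (Fin n) k) :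
    ∃ M, p ∈ MvPolynomial.restrictDegree (Fin n) k M := by
  refine ⟨p.totalDegree, MvPolynomial.restrictTotalDegree_le_restrictDegree _ _ _ ?_⟩
  rw [MvPolynomial.mem_restrictTotalDegree]

variable {B : Type*} [CommRing B] [Algebra k B]

lemma exists_lower_growth (V : ℕ → Submodule k B) (hmono : Monotone V) (h1 : (1 : B) ∈ V 0)
    (hmul : ∀ a b, V a * V b ≤ V (a + b)) (hex : ∀ x, ∃ n, x ∈ V n)
    (hfin : ∀ n, FiniteDimensional k (V n)) {n : ℕ} (φ : MvPolynomial (Fin n) k →ₐ[k] B)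
    (hφ : Function.Injective φ) :
    ∃ c, 1 ≤ c ∧ ∀ N, (N + 1) ^ n ≤ Module.finrank k (V (c * N)) := by
  choose g hg using fun i => hex (φ (MvPolynomial.X i))
  have hpow : ∀ {x : B} {a : ℕ}, x ∈ V a → ∀ j : ℕ, x ^ j ∈ V (a * j) := by
    intro x a hx j
    induction j with
    | zero => simpa using h1
    | succ j ih =>
      rw [pow_succ, mul_add, mul_one]
      exact hmul _ _ (Submodule.mul_mem_mul ih hx)
  have hprod : ∀ (s : Finset (Fin n)) (x : Fin n → B) (a : Fin n → ℕ), (∀ i, x i ∈ V (a i)) →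
      ∏ i ∈ s, x i ∈ V (∑ i ∈ s, a i) := by
    classical
    intro s x a hx
    induction s using Finset.induction_on with
    | empty => simpa using h1
    | insert i s hi ih =>
      rw [Finset.prod_insert hi, Finset.sum_insert hi]
      exact hmul _ _ (Submodule.mul_mem_mul (hx i) ih)
  -- A monomial with exponents at most N lands in filtration level N ∑ g i; the extra 1 keeps the
  -- constant positive also when n = 0.
  refine ⟨∑ i, g i + 1, by omega, fun N => ?_⟩
  have hle : (MvPolynomial.restrictDegree (Fin n) k N).map φ.toLinearMap ≤
      V ((∑ i, g i + 1) * N) := by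
    rw [restrictDegree_eq_span, Submodule.map_span, Submodule.span_le]
    rintro _ ⟨_, ⟨a, rfl⟩, rfl⟩
    have h2 := hprod Finset.univ (fun i => φ (MvPolynomial.X i) ^ (a i : ℕ)) _
      fun i => hpow (hg i) (a i)
    have h3 : φ (MvPolynomial.monomial (Finsupp.equivFunOnFinite.symm fun i => (a i : ℕ)) 1) =
        ∏ i, φ (MvPolynomial.X i) ^ (a i : ℕ) := by
      rw [MvPolynomial.monomial_eq, Finsupp.prod_fintype _ _ (fun _ => pow_zero _)]
      simp [map_prod]
    change φ _ ∈ V _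
    rw [h3]
    refine hmono ?_ h2
    rw [add_mul, Finset.sum_mul]
    exact (Finset.sum_le_sum fun i _ =>
      Nat.mul_le_mul_left _ (Nat.lt_succ_iff.mp (a i).2)).trans (Nat.le_add_right _ _)
  have := Submodule.finrank_mono hle
  rwa [LinearEquiv.finrank_eq (Submodule.equivMapOfInjective φ.toLinearMap hφ _).symm,
    finrank_restrictDegree] at this

lemma exists_upper_growth (V : ℕ → Submodule k B) (h0 : V 0 ≤ 1)
    (hgen : ∀ a, V (a + 1) ≤ V 1 * V a) (hfin : FiniteDimensional k (V 1)) {n : ℕ}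
    (φ : MvPolynomial (Fin n) k →ₐ[k] B) (hφ : φ.Finite) :
    ∃ m c, ∀ N, Module.finrank k (V N) ≤ m * (c * (N + 1) + 1) ^ n := by
  classical
  algebraize [φ.toRingHom]
  have hφ' : Module.Finite (MvPolynomial (Fin n) k) B := hφ
  obtain ⟨s, hs⟩ := Module.Finite.fg_top (R := MvPolynomial (Fin n) k) (M := B)
  set R : ℕ → Submodule k B := fun M =>
    (MvPolynomial.restrictDegree (Fin n) k M).map φ.toLinearMap with hR
  set T : Submodule k B := Submodule.span k (s : Set B) with hT
  have hRR : ∀ a b, R a * R b ≤ R (a + b) := by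
    intro a b
    rw [Submodule.mul_le]
    rintro _ ⟨p, hp, rfl⟩ _ ⟨q, hq, rfl⟩
    exact ⟨p * q, mul_mem_restrictDegree hp hq, map_mul φ p q⟩
  have hRmono : Monotone R := by
    intro a b hab
    refine Submodule.map_mono fun p hp => ?_
    rw [MvPolynomial.mem_restrictDegree] at hp ⊢
    exact fun t ht i => (hp t ht i).trans hab
  have hWmono : Monotone fun M => R M * T := fun a b hab => mul_le_mul' (hRmono hab) le_rfl
  have hex : ∀ x : B, ∃ M, x ∈ R M * T := by
    intro x
    have hx : x ∈ Submodule.span (MvPolynomial (Fin n) k) (s : Set B) := by rw [hs]; trivial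
    induction hx using Submodule.span_induction with
    | mem x hx =>
      refine ⟨0, ?_⟩
      rw [← one_mul x]
      refine Submodule.mul_mem_mul ⟨1, ?_, map_one φ⟩ (Submodule.subset_span hx)
      rw [SetLike.mem_coe, MvPolynomial.mem_restrictDegree]
      intro t ht i
      have := MvPolynomial.support_monomial_subset (s := 0) (a := (1 : k)) ht
      rw [Finset.mem_singleton] at this
      simp [this]
    | zero => exact ⟨0, zero_mem _⟩
    | add x y _ _ hx hy =>
      obtain ⟨a, ha⟩ := hx
      obtain ⟨b, hb⟩ := hy
      exact ⟨max a b, add_mem (hWmono (le_max_left a b) ha) (hWmono (le_max_right a b) hb)⟩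
    | smul p x _ hx =>
      obtain ⟨a, ha⟩ := hx
      obtain ⟨b, hb⟩ := exists_mem_restrictDegree p
      refine ⟨b + a, mul_le_mul' (hRR b a) le_rfl ?_⟩
      rw [mul_assoc, Algebra.smul_def]
      exact Submodule.mul_mem_mul ⟨p, hb, rfl⟩ ha
  have hfg : ∀ F : Submodule k B, F.FG → ∃ M, F ≤ R M * T := by
    rintro _ ⟨t, rfl⟩
    choose g hg using hex
    exact ⟨t.sup g, Submodule.span_le.mpr fun x hx => hWmono (Finset.le_sup hx) (hg x)⟩
  -- T spans the module generators over k. One constant c bounds the polynomial degrees needed to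
  -- rewrite V 1 * T, so each multiplication by V 1 costs at most c.
  obtain ⟨c, hc⟩ := hfg (V 1 * T ⊔ 1)
    (((Module.Finite.iff_fg.mp hfin).mul ⟨s, rfl⟩).sup ⟨{1}, by rw [Finset.coe_singleton, Submodule.one_eq_span]⟩)
  have hV : ∀ N, V N ≤ R (c * (N + 1)) * T := by
    intro N
    induction N with
    | zero => rw [zero_add, mul_one]; exact h0.trans (le_sup_right.trans hc)
    | succ N ih =>
      calc V (N + 1) ≤ V 1 * V N := hgen N
        _ ≤ V 1 * (R (c * (N + 1)) * T) := mul_le_mul' le_rfl ih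
        _ = R (c * (N + 1)) * (V 1 * T) := by rw [← mul_assoc, mul_comm (V 1), mul_assoc]
        _ ≤ R (c * (N + 1)) * (R c * T) := mul_le_mul' le_rfl (le_sup_left.trans hc)
        _ ≤ R (c * (N + 1) + c) * T := by
          rw [← mul_assoc]; exact mul_le_mul' (hRR _ _) le_rfl
        _ = _ := by rw [mul_add c (N + 1) 1, mul_one]
  refine ⟨s.card, c, fun N => ?_⟩
  have hspan : R (c * (N + 1)) * T = Submodule.span k (Set.range
      fun x : (Fin n → Fin (c * (N + 1) + 1)) × s => φ (MvPolynomial.monomial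
        (Finsupp.equivFunOnFinite.symm fun i => (x.1 i : ℕ)) (1 : k)) * (x.2 : B)) := by
    rw [hR, hT]
    simp only
    rw [restrictDegree_eq_span, Submodule.map_span, Submodule.span_mul_span]
    congr 1
    ext y
    simp only [Set.mem_mul, Set.mem_image, Set.mem_range, Prod.exists, Subtype.exists]
    constructor
    · rintro ⟨_, ⟨_, ⟨a, rfl⟩, rfl⟩, b, hb, rfl⟩
      exact ⟨a, b, hb, rfl⟩
    · rintro ⟨a, b, hb, rfl⟩
      exact ⟨_, ⟨_, ⟨a, rfl⟩, rfl⟩, b, hb, rfl⟩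
  have hle := hV N
  rw [hspan] at hle
  have := FiniteDimensional.span_of_finite k (Set.finite_range
      fun x : (Fin n → Fin (c * (N + 1) + 1)) × s => φ (MvPolynomial.monomial
        (Finsupp.equivFunOnFinite.symm fun i => (x.1 i : ℕ)) (1 : k)) * (x.2 : B))
  refine (Submodule.finrank_mono hle).trans ((finrank_range_le_card _).trans ?_)
  simp [mul_comm]

end Growth

/-! ### Comparison of polynomials by growth -/

lemma degree_le_of_eventually_le {a b : ℚ[X]}
    (h : ∃ N₀ : ℕ, ∀ N : ℕ, N₀ ≤ N → 0 ≤ a.eval (N : ℚ) ∧ a.eval (N : ℚ) ≤ b.eval (N : ℚ)) :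
    a.degree ≤ b.degree := by
  by_contra hlt
  push Not at hlt
  have ha : a ≠ 0 := by rintro rfl; simp at hlt
  obtain ⟨N₀, hN⟩ := h
  have h1 := (Polynomial.div_tendsto_atTop_zero_of_degree_lt b a hlt).comp
    tendsto_natCast_atTop_atTop
  have h2 := (Polynomial.eventually_atTop_not_isRoot a ha)
  have h3 := (tendsto_natCast_atTop_atTop (R := ℚ)).eventually h2
  obtain ⟨N, hN1, hN2, hN3⟩ := ((h1.eventually (gt_mem_nhds one_pos)).and
    (h3.and (Filter.eventually_ge_atTop N₀))).exists
  obtain ⟨h4, h5⟩ := hN N hN3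
  have h6 : 0 < a.eval (N : ℚ) := lt_of_le_of_ne h4 (Ne.symm hN2)
  simp only [Function.comp_apply] at hN1
  rw [div_lt_one h6] at hN1
  linarith

lemma leadingCoeff_nonneg_of_eventually {p : ℚ[X]} {N₀ : ℕ}
    (h : ∀ N : ℕ, N₀ ≤ N → 0 ≤ p.eval (N : ℚ)) : 0 ≤ p.leadingCoeff := by
  by_contra hneg
  push Not at hneg
  rcases le_or_gt p.degree 0 with h0 | h0
  · rw [Polynomial.eq_C_of_degree_le_zero h0] at hneg h
    have := h N₀ le_rfl
    simp at this hneg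
    linarith
  · have h1 := (p.tendsto_atBot_of_leadingCoeff_nonpos h0 hneg.le).comp
      tendsto_natCast_atTop_atTop
    obtain ⟨N, hN1, hN2⟩ := ((h1.eventually (Filter.eventually_lt_atBot 0)).and
      (Filter.eventually_ge_atTop N₀)).exists
    exact absurd (h N hN2) (not_le.mpr hN1)

lemma exists_isMultiplicity {H : ℕ → ℕ} {p : ℚ[X]} (hp : IsHilbertPolynomial H p) :
    ∃ e : ℕ, IsMultiplicity H e ∧
      (p ≠ 0 → 0 < e ∧ (e : ℚ) = (p.natDegree.factorial : ℚ) * p.leadingCoeff) := by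
  by_cases h0 : p = 0
  · exact ⟨∑ᶠ u, H u, ⟨p, hp, Or.inr ⟨h0, rfl⟩⟩, fun h => absurd h0 h⟩
  obtain ⟨u₀, hu⟩ := hp
  have hnn : 0 ≤ p.leadingCoeff :=
    leadingCoeff_nonneg_of_eventually (N₀ := u₀) fun N hN => by
      rw [← hu N hN]; exact Nat.cast_nonneg _
  have hpos : 0 < p.leadingCoeff :=
    lt_of_le_of_ne hnn (Ne.symm (Polynomial.leadingCoeff_ne_zero.mpr h0))
  -- The top finite difference of p is the constant δ! times the leading coefficient. Computed from
  -- the values of H it is an integer, and nonnegativity of H makes it positive.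
  have h1 := congrFun p.fwdDiff_iter_degree_eq_factorial (u₀ : ℚ)
  rw [fwdDiff_iter_eq_sum_shift] at h1
  have h2 : ∃ z : ℤ, (z : ℚ) = (p.natDegree.factorial : ℚ) * p.leadingCoeff := by
    refine ⟨∑ j ∈ Finset.range (p.natDegree + 1),
      ((-1) ^ (p.natDegree - j) * (p.natDegree.choose j : ℤ)) * (H (u₀ + j) : ℤ), ?_⟩
    rw [Pi.smul_apply, smul_eq_mul, mul_comm] at h1
    simp only [Pi.natCast_apply] at h1
    rw [← h1, Int.cast_sum]
    refine Finset.sum_congr rfl fun j _ => ?_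
    have := hu (u₀ + j) (by omega)
    push_cast at this
    rw [nsmul_eq_mul, mul_one, ← this, zsmul_eq_mul]
    push_cast
    ring
  obtain ⟨z, hz⟩ := h2
  have hzpos : 0 < z := by
    have : (0 : ℚ) < z := by rw [hz]; positivity
    exact_mod_cast this
  lift z to ℕ using hzpos.le
  refine ⟨z, ⟨p, ⟨u₀, hu⟩, Or.inl ⟨h0, ?_⟩⟩, fun _ => ⟨by exact_mod_cast hzpos, ?_⟩⟩ <;>
  · rw [← hz]; simp

/-- The degree of a polynomial whose sums have prescribed growth. -/
lemma degree_of_sum_growth {H S : ℕ → ℕ} {p : ℚ[X]} (hp : IsHilbertPolynomial H p)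
    (hS : ∀ N, S (N + 1) = S N + H (N + 1)) {n c m c' : ℕ} (hc : 1 ≤ c)
    (hlow : ∀ N, (N + 1) ^ n ≤ S (c * N)) (hup : ∀ N, S N ≤ m * (c' * (N + 1) + 1) ^ n) :
    (p = 0 ∧ n = 0) ∨ (p ≠ 0 ∧ p.natDegree + 1 = n) := by
  obtain ⟨u₀, hu⟩ := hp
  have key : ∀ D, p ∈ Polynomial.degreeLT ℚ D → ∃ q ∈ Polynomial.degreeLT ℚ (D + 1),
      (∀ N : ℕ, u₀ ≤ N → (S N : ℚ) = q.eval (N : ℚ)) := by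
    intro D hD
    obtain ⟨q, hq, hqp⟩ := exists_eval_sub_eval_eq hD
    refine ⟨q + Polynomial.C ((S u₀ : ℚ) - q.eval (u₀ : ℚ)), add_mem hq ?_, fun u huu => ?_⟩
    · rw [Polynomial.mem_degreeLT]
      exact Polynomial.degree_C_le.trans_lt (by exact_mod_cast Nat.succ_pos D)
    induction u, huu using Nat.le_induction with
    | base => simp
    | succ u huu ih =>
      have h1 := hqp ((u + 1 : ℕ) : ℚ)
      rw [← hu (u + 1) (by omega)] at h1
      rw [hS, Nat.cast_add, ih, ← h1]
      push_cast
      simp only [add_sub_cancel_right, Polynomial.eval_add, Polynomial.eval_C]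
      ring
  -- Any polynomial agreeing with the cumulative function S for large N is squeezed between two
  -- bounds of order N^n.
  have hdeg : ∀ q : ℚ[X], (∀ N : ℕ, u₀ ≤ N → (S N : ℚ) = q.eval (N : ℚ)) →
      q.degree = n := by
    intro q hq
    have hq0 : q ≠ 0 := by
      rintro rfl
      have h1 := hlow u₀
      have h2 := hq (c * u₀) (Nat.le_mul_of_pos_left _ hc)
      simp at h2
      rw [h2] at h1
      have : 0 < (u₀ + 1) ^ n := by positivity
      omega
    apply le_antisymm
    · refine (degree_le_of_eventually_le (b := Polynomial.C (m : ℚ) *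
        (Polynomial.C (c' : ℚ) * (Polynomial.X + 1) + 1) ^ n) ⟨u₀, fun N hN => ?_⟩).trans ?_
      · rw [← hq N hN]
        refine ⟨Nat.cast_nonneg _, ?_⟩
        have : ((S N : ℕ) : ℚ) ≤ ((m * (c' * (N + 1) + 1) ^ n : ℕ) : ℚ) := by exact_mod_cast hup N
        simpa using this
      · refine Polynomial.degree_le_of_natDegree_le ((Polynomial.natDegree_C_mul_le _ _).trans ?_)
        refine Polynomial.natDegree_pow_le.trans ?_
        have : (Polynomial.C (c' : ℚ) * (Polynomial.X + 1) + 1).natDegree ≤ 1 := by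
          compute_degree
        calc n * _ ≤ n * 1 := Nat.mul_le_mul_left n this
          _ = n := mul_one n
    · have h1 := degree_le_of_eventually_le (a := (Polynomial.X + 1) ^ n)
        (b := q.comp (Polynomial.C (c : ℚ) * Polynomial.X)) ⟨u₀, fun N hN => ?_⟩
      · have h2 : ((Polynomial.X + 1 : ℚ[X]) ^ n).degree = n := by
          rw [Polynomial.degree_pow, ← Polynomial.C_1, Polynomial.degree_X_add_C]; simp
        rw [h2] at h1
        refine h1.trans ?_
        refine Polynomial.degree_le_natDegree.trans ?_
        rw [Polynomial.natDegree_comp, Polynomial.natDegree_C_mul_X _ (by positivity), mul_one,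
          Polynomial.degree_eq_natDegree hq0]
      · have h3 := hq (c * N) (hN.trans (Nat.le_mul_of_pos_left _ hc))
        have h4 : (((N + 1) ^ n : ℕ) : ℚ) ≤ (S (c * N) : ℚ) := by exact_mod_cast hlow N
        rw [h3] at h4
        simp only [Polynomial.eval_pow, Polynomial.eval_add, Polynomial.eval_X,
          Polynomial.eval_one, Polynomial.eval_comp, Polynomial.eval_mul, Polynomial.eval_C]
        push_cast at h4
        exact ⟨by positivity, h4⟩
  have hlast : ∀ D, p ∈ Polynomial.degreeLT ℚ D → n ≤ D := by
    intro D hD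
    obtain ⟨q, hq, hqS⟩ := key D hD
    rw [Polynomial.mem_degreeLT, hdeg q hqS] at hq
    exact Nat.lt_succ_iff.mp (by exact_mod_cast hq)
  -- Eventually p is the backward difference of a polynomial of degree n. With `hlast` this
  -- determines the degree of p, including the case p = 0.
  have hfirst : p ∈ Polynomial.degreeLT ℚ n := by
    obtain ⟨q, -, hqS⟩ := key (p.natDegree + 1) (Polynomial.mem_degreeLT.mpr
      (Polynomial.degree_le_natDegree.trans_lt (by exact_mod_cast Nat.lt_succ_self _)))
    have hqn : q ∈ Polynomial.degreeLT ℚ (n + 1) := by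
      rw [Polynomial.mem_degreeLT, hdeg q hqS]
      exact_mod_cast Nat.lt_succ_self n
    have h1 := sub_taylor_mem_degreeLT hqn
    convert h1 using 1
    refine Polynomial.eq_of_infinite_eval_eq _ _
      ((Set.infinite_range_of_injective (f := fun N : ℕ => ((N + u₀ + 1 : ℕ) : ℚ)) ?_).mono ?_)
    · intro a b hab
      have : a + u₀ + 1 = b + u₀ + 1 := Nat.cast_injective hab
      omega
    · rintro _ ⟨N, rfl⟩
      have h2 := hS (N + u₀)
      have h3 : ((S (N + u₀ + 1) : ℕ) : ℚ) = S (N + u₀) + H (N + u₀ + 1) := by exact_mod_cast h2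
      rw [hqS _ (by omega), hqS _ (by omega), hu _ (by omega)] at h3
      rw [Set.mem_ofPred_eq, Polynomial.eval_sub, Polynomial.taylor_eval, h3]
      push_cast
      ring_nf
  rcases eq_or_ne p 0 with h0 | h0
  · left
    exact ⟨h0, Nat.le_zero.mp (hlast 0 (by simp [h0]))⟩
  · right
    refine ⟨h0, le_antisymm ?_ (hlast _ (Polynomial.mem_degreeLT.mpr
      (Polynomial.degree_le_natDegree.trans_lt (by exact_mod_cast Nat.lt_succ_self _))))⟩
    rw [Polynomial.mem_degreeLT, Polynomial.degree_eq_natDegree h0] at hfirst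
    exact_mod_cast hfirst

/-! ### Dimension of graded quotients and degree of the Hilbert polynomial -/

section Dimension

variable {k A : Type*} [Field k] [CommRing A] [Algebra k A] (𝒜 : ℕ → Submodule k A)

/-- The elements of degree `≤ N`. -/
def degreeLEPart (N : ℕ) : Submodule k A := (Finset.range (N + 1)).sup 𝒜

variable {𝒜}

lemma le_degreeLEPart {u N : ℕ} (h : u ≤ N) : 𝒜 u ≤ degreeLEPart 𝒜 N :=
  Finset.le_sup (f := 𝒜) (Finset.mem_range.mpr (Nat.lt_succ_of_le h))

lemma degreeLEPart_mono : Monotone (degreeLEPart 𝒜) :=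
  fun _ _ h => Finset.sup_mono (Finset.range_mono (Nat.succ_le_succ h))

lemma degreeLEPart_succ (N : ℕ) : degreeLEPart 𝒜 (N + 1) = 𝒜 (N + 1) ⊔ degreeLEPart 𝒜 N := by
  rw [degreeLEPart, Finset.range_add_one, Finset.sup_insert]
  rfl

variable [GradedAlgebra 𝒜]

lemma degreeLEPart_mul_le (a b : ℕ) :
    degreeLEPart 𝒜 a * degreeLEPart 𝒜 b ≤ degreeLEPart 𝒜 (a + b) := by
  rw [degreeLEPart, degreeLEPart, Finset.sup_eq_iSup, Finset.sup_eq_iSup]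
  simp only [Submodule.iSup_mul, Submodule.mul_iSup, iSup_le_iff, Finset.mem_range]
  intro j hj i hi
  refine le_trans ?_ (le_degreeLEPart (by omega : i + j ≤ a + b))
  rw [Submodule.mul_le]
  exact fun x hx y hy => SetLike.mul_mem_graded hx hy

lemma exists_mem_degreeLEPart (x : A) : ∃ N, x ∈ degreeLEPart 𝒜 N := by
  classical
  refine ⟨(DirectSum.decompose 𝒜 x).support.sup id, ?_⟩
  have h : ∑ i ∈ (DirectSum.decompose 𝒜 x).support, (DirectSum.decompose 𝒜 x i : A) ∈
      degreeLEPart 𝒜 ((DirectSum.decompose 𝒜 x).support.sup id) :=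
    Submodule.sum_mem _ fun i hi =>
      le_degreeLEPart (Finset.le_sup (f := id) hi) (SetLike.coe_mem (DirectSum.decompose 𝒜 x i))
  rwa [DirectSum.sum_support_decompose 𝒜 x] at h

lemma decompose_eq_zero_of_mem_degreeLEPart {N u : ℕ} (h : N < u) {x : A}
    (hx : x ∈ degreeLEPart 𝒜 N) : (DirectSum.decompose 𝒜 x u : A) = 0 := by
  have : degreeLEPart 𝒜 N ≤ LinearMap.ker (GradedAlgebra.proj 𝒜 u) := by
    refine Finset.sup_le fun i hi => fun y hy => ?_
    rw [LinearMap.mem_ker, GradedAlgebra.proj_apply]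
    exact DirectSum.decompose_of_mem_ne 𝒜 hy (by have := Finset.mem_range.mp hi; omega)
  exact this hx

lemma IsStandardGraded.finiteDimensional_degreeLEPart (hA : IsStandardGraded 𝒜) (N : ℕ) :
    FiniteDimensional k (degreeLEPart 𝒜 N) := by
  have := hA.finiteDimensional
  exact Submodule.finiteDimensional_finset_sup _ _

lemma IsStandardGraded.degreeLEPart_succ_le (hA : IsStandardGraded 𝒜) (N : ℕ) :
    degreeLEPart 𝒜 (N + 1) ≤ degreeLEPart 𝒜 1 * degreeLEPart 𝒜 N := by
  rw [degreeLEPart_succ]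
  refine sup_le ?_ ?_
  · refine (hA.le_pow _).trans ?_
    rw [pow_succ']
    refine mul_le_mul' (le_degreeLEPart le_rfl) (le_trans ?_ (le_degreeLEPart le_rfl))
    clear hA
    induction N with
    | zero =>
      rw [pow_zero, Submodule.one_le]
      exact SetLike.one_mem_graded 𝒜
    | succ N ih =>
      rw [pow_succ, Submodule.mul_le]
      exact fun x hx y hy => SetLike.mul_mem_graded (ih hx) hy
  · intro x hx
    rw [← one_mul x]
    exact Submodule.mul_mem_mul (le_degreeLEPart zero_le_one (SetLike.one_mem_graded 𝒜)) hx

/-- The Hilbert polynomial of a standard graded algebra of dimension `δ` has degree `δ - 1`. -/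
theorem IsStandardGraded.exists_ringKrullDim (hA : IsStandardGraded 𝒜) {J : Ideal A}
    (hJ : J.IsHomogeneous 𝒜) (hJ' : J ≠ ⊤) {p : ℚ[X]}
    (hp : IsHilbertPolynomial (quotientHilbertFun 𝒜 J) p) :
    ∃ n : ℕ, ringKrullDim (A ⧸ J) = (n : WithBot ℕ∞) ∧
      ((p = 0 ∧ n = 0) ∨ (p ≠ 0 ∧ p.natDegree + 1 = n)) := by
  have := hA.finiteType
  have := Ideal.Quotient.nontrivial_iff.mpr hJ'
  have hft : Algebra.FiniteType k (A ⧸ J) :=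
    Algebra.FiniteType.of_surjective (Ideal.Quotient.mkₐ k J) (Ideal.Quotient.mkₐ_surjective k J)
  -- Noether normalization: the same n is the Krull dimension and the growth exponent of the degree
  -- filtration.
  obtain ⟨n, φ, hinj, hφ⟩ := exists_finite_inj_algHom_of_fg k (A ⧸ J)
  set π := Ideal.Quotient.mkₐ k J with hπ
  set V : ℕ → Submodule k (A ⧸ J) := fun N => (degreeLEPart 𝒜 N).map π.toLinearMap with hV
  have hVfin : ∀ N, FiniteDimensional k (V N) := fun N => by
    have := hA.finiteDimensional_degreeLEPart N
    exact inferInstanceAs (FiniteDimensional k ((degreeLEPart 𝒜 N).map π.toLinearMap))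
  have hVmul : ∀ a b, V a * V b = (degreeLEPart 𝒜 a * degreeLEPart 𝒜 b).map π.toLinearMap :=
    fun a b => (Submodule.map_mul _ _ π).symm
  obtain ⟨c, hc, hlow⟩ := exists_lower_growth V
    (fun a b h => Submodule.map_mono (degreeLEPart_mono h))
    ⟨1, le_degreeLEPart le_rfl (SetLike.one_mem_graded 𝒜), map_one π⟩
    (fun a b => by rw [hVmul]; exact Submodule.map_mono (degreeLEPart_mul_le a b))
    (fun x => by
      obtain ⟨y, rfl⟩ := Ideal.Quotient.mkₐ_surjective k J x
      obtain ⟨N, hN⟩ := exists_mem_degreeLEPart (𝒜 := 𝒜) y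
      exact ⟨N, y, hN, rfl⟩) hVfin φ hinj
  obtain ⟨m, c', hup⟩ := exists_upper_growth V
    (by
      have h0 : degreeLEPart 𝒜 0 ≤ 1 := by
        refine Finset.sup_le fun i hi => ?_
        rw [Finset.mem_range, zero_add, Nat.lt_one_iff] at hi
        subst hi
        exact (hA.le_pow 0).trans (pow_zero _).le
      refine (Submodule.map_mono h0).trans ?_
      rw [Submodule.map_one])
    (fun a => by rw [hVmul]; exact Submodule.map_mono (hA.degreeLEPart_succ_le a))
    (hVfin 1) φ hφ
  have hS : ∀ N, Module.finrank k (V (N + 1)) =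
      Module.finrank k (V N) + quotientHilbertFun 𝒜 J (N + 1) := by
    intro N
    have hfin := hVfin N
    have := hA.finiteDimensional (N + 1)
    have h1 : V (N + 1) = V N ⊔ (𝒜 (N + 1)).map π.toLinearMap := by
      rw [hV]
      simp only
      rw [degreeLEPart_succ, Submodule.map_sup, sup_comm]
    have h2 : V N ⊓ (𝒜 (N + 1)).map π.toLinearMap = ⊥ := by
      rw [Submodule.eq_bot_iff]
      rintro _ ⟨⟨x, hx, rfl⟩, y, hy, hxy⟩
      have h3 : y - x ∈ J := Ideal.Quotient.eq.mp hxy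
      have h4 := hJ (N + 1) h3
      rw [DirectSum.decompose_sub, DirectSum.sub_apply, AddSubgroupClass.coe_sub,
        DirectSum.decompose_of_mem_same 𝒜 hy,
        decompose_eq_zero_of_mem_degreeLEPart (Nat.lt_succ_self N) hx, sub_zero] at h4
      rw [← hxy]
      exact Ideal.Quotient.eq_zero_iff_mem.mpr h4
    have h3 := Submodule.finrank_sup_add_finrank_inf_eq (V N) ((𝒜 (N + 1)).map π.toLinearMap)
    rw [h2, finrank_bot, add_zero, ← h1] at h3
    exact h3
  refine ⟨n, ?_, degree_of_sum_growth hp hS hc hlow hup⟩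
  algebraize [φ.toRingHom]
  have hfin : Module.Finite (MvPolynomial (Fin n) k) (A ⧸ J) := hφ
  rw [← ringKrullDim_eq_of_isIntegral (R := MvPolynomial (Fin n) k) (S := A ⧸ J) hinj,
    MvPolynomial.ringKrullDim_of_isNoetherianRing, ringKrullDim_eq_zero_of_field]
  simp

end Dimension

/-! ### `d`-sequences -/

section DSequence

variable {A : Type*} [CommRing A]

/-- The ideal `(f_1, …, f_i)`. -/
def partialIdeal (f : ℕ → A) (i : ℕ) : Ideal A := Ideal.span (f '' Set.Icc 1 i)

lemma partialIdeal_zero (f : ℕ → A) : partialIdeal f 0 = ⊥ := by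
  simp [partialIdeal]

lemma partialIdeal_mono (f : ℕ → A) : Monotone (partialIdeal f) :=
  fun _ _ h => Ideal.span_mono (Set.image_mono (Set.Icc_subset_Icc_right h))

lemma mem_partialIdeal (f : ℕ → A) {j i : ℕ} (h1 : 1 ≤ j) (h2 : j ≤ i) : f j ∈ partialIdeal f i :=
  Ideal.subset_span ⟨j, ⟨h1, h2⟩, rfl⟩

lemma partialIdeal_succ (f : ℕ → A) (i : ℕ) :
    partialIdeal f (i + 1) = partialIdeal f i ⊔ Ideal.span {f (i + 1)} := by
  have : Set.Icc 1 (i + 1) = Set.Icc 1 i ∪ {i + 1} := by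
    ext x; simp; omega
  rw [partialIdeal, this, Set.image_union, Set.image_singleton, Ideal.span_union]
  rfl

lemma colonIdeal_succ (f : ℕ → A) (i : ℕ) :
    colonIdeal f (i + 1) = (partialIdeal f i).colon {f (i + 1)} := by
  have : Set.Ico 1 (i + 1) = Set.Icc 1 i := by ext x; simp
  rw [colonIdeal, this]
  rfl

lemma mem_colonIdeal_succ {f : ℕ → A} {i : ℕ} {x : A} :
    x ∈ colonIdeal f (i + 1) ↔ x * f (i + 1) ∈ partialIdeal f i := by
  rw [colonIdeal_succ, Submodule.mem_colon_singleton, smul_eq_mul]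

variable {r : ℕ} {f : ℕ → A}

lemma IsDSequence.mem_of_mul_mem (h : IsDSequence r f) {i j : ℕ} (hij : i + 1 ≤ j) (hj : j ≤ r)
    {x : A} (hx : x * (f (i + 1) * f j) ∈ partialIdeal f i) : x * f j ∈ partialIdeal f i := by
  have h1 := h.colon_eq i j hij hj
  have h2 : x ∈ (Ideal.span (f '' Set.Icc 1 i)).colon {f (i + 1) * f j} :=
    Submodule.mem_colon_singleton.mpr hx
  rw [h1] at h2
  exact Submodule.mem_colon_singleton.mp h2

lemma IsDSequence.mul_mem_of_mul_mem (h : IsDSequence r f) {i j : ℕ} (hij : i + 1 ≤ j)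
    (hj : j ≤ r) {x : A} (hx : x * f (i + 1) ∈ partialIdeal f i) : x * f j ∈ partialIdeal f i := by
  refine h.mem_of_mul_mem hij hj ?_
  rw [← mul_assoc]
  exact Ideal.mul_mem_right _ _ hx

lemma IsDSequence.colonIdeal_ne_top (h : IsDSequence r f) {i : ℕ} (hi : i < r) :
    colonIdeal f (i + 1) ≠ ⊤ := by
  rw [Ideal.ne_top_iff_one, mem_colonIdeal_succ, one_mul]
  intro hmem
  refine h.notMem (i + 1) ⟨by omega, hi⟩ (Ideal.span_mono (Set.image_mono ?_) hmem)
  intro x hx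
  rw [Set.mem_Icc] at hx
  simp
  omega

lemma IsDSequence.colonIdeal_le (h : IsDSequence r f) {i : ℕ} (hi : i + 1 < r) :
    colonIdeal f (i + 1) ≤ colonIdeal f (i + 1 + 1) := by
  intro x hx
  rw [mem_colonIdeal_succ] at hx ⊢
  exact partialIdeal_mono f (Nat.le_succ i) (h.mul_mem_of_mul_mem (by omega) hi hx)

lemma IsDSequence.ringKrullDim_succ_le (h : IsDSequence r f) {i : ℕ} (hi : i + 1 < r) :
    ringKrullDim (A ⧸ colonIdeal f (i + 1 + 1)) + 1 ≤ ringKrullDim (A ⧸ colonIdeal f (i + 1)) := by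
  refine ringKrullDim_succ_le_of_surjective (Ideal.Quotient.factor (h.colonIdeal_le hi))
    (Ideal.Quotient.factor_surjective _) (r := Ideal.Quotient.mk _ (f (i + 1))) ?_ ?_
  · rw [mem_nonZeroDivisors_iff_right]
    intro x hx
    obtain ⟨x, rfl⟩ := Ideal.Quotient.mk_surjective x
    rw [← map_mul, Ideal.Quotient.eq_zero_iff_mem, mem_colonIdeal_succ, mul_assoc] at hx
    rw [Ideal.Quotient.eq_zero_iff_mem, mem_colonIdeal_succ]
    exact h.mem_of_mul_mem le_rfl hi.le hx
  · rw [Ideal.Quotient.factor_mk, Ideal.Quotient.eq_zero_iff_mem, mem_colonIdeal_succ]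
    exact Ideal.mul_mem_right _ _ (mem_partialIdeal f (by omega) le_rfl)

lemma partialIdeal_succ_mul (f : ℕ → A) (i : ℕ) (K : Ideal A) :
    partialIdeal f (i + 1) * K = partialIdeal f i * K ⊔ Ideal.span {f (i + 1)} * K := by
  rw [partialIdeal_succ, Ideal.sup_mul]

/-- For a `d`-sequence, `((f_1, …, f_i) : f_{i+1}) ∩ I^(n+1)` is contained in
`(f_1, …, f_i) I^n`. -/
theorem IsDSequence.mem_mul_pow (h : IsDSequence r f) (n : ℕ) {i : ℕ} (hi : i < r) {x : A}
    (hx : x ∈ partialIdeal f r ^ (n + 1)) (hxf : x * f (i + 1) ∈ partialIdeal f i) :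
    x ∈ partialIdeal f i * partialIdeal f r ^ n := by
  induction n generalizing i x with
  | zero =>
    -- Descend from k = r. If x = y + a f_{k+1} with y ∈ J_k, then x f_{k+1} ∈ J_k gives a f_{k+1}²
    -- ∈ J_k, and one factor f_{k+1} can be cancelled.
    have key : ∀ k, i ≤ k → k ≤ r → x ∈ partialIdeal f k := by
      intro k hik hkr
      induction hkr using Nat.decreasingInduction with
      | self => simpa using hx
      | of_succ k hk ih =>
        have h1 := ih (by omega)
        rw [partialIdeal_succ] at h1
        obtain ⟨y, hy, b, hb, rfl⟩ := Submodule.mem_sup.mp h1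
        obtain ⟨a, rfl⟩ := Ideal.mem_span_singleton'.mp hb
        have h2 := partialIdeal_mono f hik (h.mul_mem_of_mul_mem (by omega : i + 1 ≤ k + 1) hk hxf)
        rw [add_mul, (partialIdeal f k).add_mem_iff_right (Ideal.mul_mem_right _ _ hy),
          mul_assoc] at h2
        exact add_mem hy (h.mem_of_mul_mem le_rfl hk h2)
    simpa using key i le_rfl hi.le
  | succ n ihn =>
    have key : ∀ k, i ≤ k → k ≤ r → x ∈ partialIdeal f k * partialIdeal f r ^ (n + 1) := by
      intro k hik hkr
      induction hkr using Nat.decreasingInduction with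
      | self => rwa [← pow_succ']
      | of_succ k hk ih =>
        have h1 := ih (by omega)
        rw [partialIdeal_succ_mul] at h1
        obtain ⟨y, hy, b, hb, rfl⟩ := Submodule.mem_sup.mp h1
        obtain ⟨a, ha, rfl⟩ := Ideal.mem_span_singleton_mul.mp hb
        have h2 := partialIdeal_mono f hik (h.mul_mem_of_mul_mem (by omega : i + 1 ≤ k + 1) hk hxf)
        have hy' : y ∈ partialIdeal f k := Ideal.mul_le_left hy
        rw [add_mul, (partialIdeal f k).add_mem_iff_right
          (Ideal.mul_mem_right _ _ hy'), mul_comm (f (k + 1)) a,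
          mul_assoc] at h2
        -- The coefficient a lies in I^(n+1) and a f_{k+1} ∈ J_k, so the induction on n, applied at
        -- index k rather than i, puts a in J_k I^n.
        have h3 := ihn hk ha (h.mem_of_mul_mem le_rfl hk h2)
        refine add_mem hy ?_
        rw [mul_comm (f (k + 1)) a, pow_succ, ← mul_assoc]
        exact Ideal.mul_mem_mul h3 (mem_partialIdeal f (by omega) hk)
    exact key i le_rfl hi.le

/-- Identifies the kernel of multiplication by f_{i+1} from I^(n+1) to I^(n+2) / J_i I^(n+1), as
needed for the recursion. -/
lemma IsDSequence.pow_inf_colon (h : IsDSequence r f) (n : ℕ) {i : ℕ} (hi : i < r) :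
    partialIdeal f r ^ (n + 1) ⊓
      (partialIdeal f i * partialIdeal f r ^ (n + 1)).colon {f (i + 1)} =
    partialIdeal f i * partialIdeal f r ^ n := by
  ext x
  rw [Submodule.mem_inf, Submodule.mem_colon_singleton, smul_eq_mul]
  constructor
  · rintro ⟨h1, h2⟩
    exact h.mem_mul_pow n hi h1 (Ideal.mul_le_left h2)
  · intro hx
    refine ⟨?_, ?_⟩
    · rw [pow_succ']
      exact Ideal.mul_mono_left (partialIdeal_mono f hi.le) hx
    · rw [pow_succ, ← mul_assoc]
      exact Ideal.mul_mem_mul hx (mem_partialIdeal f (by omega) hi)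

end DSequence

/-! ### The Hilbert function of the Rees algebra of a `d`-sequence -/

section Rees

variable {k A : Type*} [Field k] [CommRing A] [Algebra k A] {𝒜 : ℕ → Submodule k A}

lemma reesHilbertFun_eq (I : Ideal A) (u v : ℕ) :
    reesHilbertFun 𝒜 I u v = Module.finrank k (gradedPart 𝒜 (I ^ v) u) := by
  let L : gradedPart 𝒜 (I ^ v) u →ₗ[k] reesPiece 𝒜 I u v :=
    { toFun := fun a => ⟨⟨monomial v (a : A), reesAlgebra.monomial_mem.mpr a.2.2⟩,
        (a : A), a.2.2, a.2.1, rfl⟩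
      map_add' := fun a b => Subtype.ext (Subtype.ext (map_add (monomial v) (a : A) b))
      map_smul' := fun c a =>
        Subtype.ext (Subtype.ext (Polynomial.smul_monomial c v (a : A)).symm) }
  refine (LinearEquiv.finrank_eq (LinearEquiv.ofBijective L ⟨?_, ?_⟩)).symm
  · intro a b hab
    ext
    exact Polynomial.monomial_injective v (congrArg (fun x => (x.1 : A[X])) hab)
  · rintro ⟨x, a, ha, ha', hx⟩
    exact ⟨⟨a, ha', ha⟩, Subtype.ext (Subtype.ext hx.symm)⟩

variable [GradedAlgebra 𝒜] {r : ℕ} {f : ℕ → A} {d : ℕ → ℕ}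

lemma partialIdeal_isHomogeneous (hf : ∀ j ∈ Set.Icc 1 r, f j ∈ 𝒜 (d j)) {i : ℕ} (hi : i ≤ r) :
    (partialIdeal f i).IsHomogeneous 𝒜 := by
  refine Ideal.homogeneous_span 𝒜 _ ?_
  rintro _ ⟨j, hj, rfl⟩
  exact ⟨d j, hf j ⟨hj.1, hj.2.trans hi⟩⟩

lemma partialIdeal_pow_isHomogeneous (hf : ∀ j ∈ Set.Icc 1 r, f j ∈ 𝒜 (d j)) (n : ℕ) :
    (partialIdeal f r ^ n).IsHomogeneous 𝒜 := by
  induction n with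
  | zero => rw [pow_zero, Ideal.one_eq_top]; exact Ideal.IsHomogeneous.top 𝒜
  | succ n ih => rw [pow_succ]; exact ih.mul (partialIdeal_isHomogeneous hf le_rfl)

lemma colonIdeal_isHomogeneous (hf : ∀ j ∈ Set.Icc 1 r, f j ∈ 𝒜 (d j)) {i : ℕ} (hi : i < r) :
    (colonIdeal f (i + 1)).IsHomogeneous 𝒜 := by
  rw [colonIdeal_succ]
  exact (partialIdeal_isHomogeneous hf hi.le).colon (hf (i + 1) ⟨by omega, hi⟩)

variable (𝒜) in
/-- The Hilbert function of `I^v / (f_1, …, f_i) I^(v-1)`. -/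
noncomputable def powQuotientHilbertFun (f : ℕ → A) (r i v u : ℕ) : ℚ :=
  (Module.finrank k (gradedPart 𝒜 (partialIdeal f r ^ v) u) : ℚ) -
    Module.finrank k (gradedPart 𝒜 (partialIdeal f i * partialIdeal f r ^ (v - 1)) u)

lemma powQuotientHilbertFun_one (hA : IsStandardGraded 𝒜)
    (hf : ∀ j ∈ Set.Icc 1 r, f j ∈ 𝒜 (d j)) {i : ℕ} (hi : i < r) (w : ℕ) :
    powQuotientHilbertFun 𝒜 f r i 1 (w + d (i + 1)) =
      powQuotientHilbertFun 𝒜 f r (i + 1) 1 (w + d (i + 1)) +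
        quotientHilbertFun 𝒜 (colonIdeal f (i + 1)) w := by
  have h1 := hA.finrank_sup_mul (Ideal.IsHomogeneous.top 𝒜) (partialIdeal_isHomogeneous hf hi.le)
    (hf (i + 1) ⟨by omega, hi⟩) w
  rw [Ideal.mul_top, top_inf_eq, ← partialIdeal_succ, ← colonIdeal_succ] at h1
  have h2 := hA.quotientHilbertFun_add (colonIdeal f (i + 1)) w
  have h4 : gradedPart 𝒜 (⊤ : Ideal A) w = 𝒜 w := by
    ext x; simp [mem_gradedPart]
  rw [h4, ← h2] at h1
  have h5 : ∀ j, partialIdeal f j * partialIdeal f r ^ (1 - 1) = partialIdeal f j := by simp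
  rw [powQuotientHilbertFun, powQuotientHilbertFun, h5, h5]
  have h3 := congrArg (Nat.cast : ℕ → ℚ) h1
  push_cast at h3
  linarith

lemma powQuotientHilbertFun_succ (hA : IsStandardGraded 𝒜) (hseq : IsDSequence r f)
    (hf : ∀ j ∈ Set.Icc 1 r, f j ∈ 𝒜 (d j)) {i : ℕ} (hi : i < r) (n w : ℕ) :
    powQuotientHilbertFun 𝒜 f r i (n + 2) (w + d (i + 1)) =
      powQuotientHilbertFun 𝒜 f r (i + 1) (n + 2) (w + d (i + 1)) +
        powQuotientHilbertFun 𝒜 f r i (n + 1) w := by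
  have h1 := hA.finrank_sup_mul (partialIdeal_pow_isHomogeneous hf (n + 1))
    ((partialIdeal_isHomogeneous hf hi.le).mul (partialIdeal_pow_isHomogeneous hf (n + 1)))
    (hf (i + 1) ⟨by omega, hi⟩) w
  rw [hseq.pow_inf_colon n hi, ← partialIdeal_succ_mul] at h1
  rw [powQuotientHilbertFun, powQuotientHilbertFun, powQuotientHilbertFun, Nat.add_sub_cancel,
    show n + 2 - 1 = n + 1 by omega]
  have h3 := congrArg (Nat.cast : ℕ → ℚ) h1
  push_cast at h3
  linarith

end Rees

/-! ### The main theorem -/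

/-- The coefficient of u^(D-1) detects the degree; in the application it is e(A/I_1) > 0. For D = 0
only the zero polynomial remains, in accordance with the convention -1. -/
lemma hilbertDegree_eq {D : ℕ} {Q : MvPolynomial (Fin 2) ℚ} (hQ : Q ∈ bivDegreeLT D)
    (h : ∀ j, j + 1 = D → bivSymbol Q j 0 ≠ 0) :
    hilbertDegree Q = (D : ℤ) - 1 ∧ Q.totalDegree = D - 1 := by
  rcases D with _ | n
  · rw [eq_zero_of_mem_bivDegreeLT_zero hQ]
    simp [hilbertDegree]
  have hc : Q.coeff (bivExp n 0) ≠ 0 := fun h0 => h n rfl (by rw [bivSymbol, h0, mul_zero])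
  have hQ0 : Q ≠ 0 := by rintro rfl; simp at hc
  have hdeg : Q.totalDegree = n := by
    apply le_antisymm
    · refine Finset.sup_le fun m hm => ?_
      rw [Finsupp.sum_fintype _ _ (fun _ => rfl), Fin.sum_univ_two]
      by_contra hlt
      exact MvPolynomial.mem_support_iff.mp hm (hQ m (by omega))
    · have := MvPolynomial.le_totalDegree (MvPolynomial.mem_support_iff.mpr hc)
      rw [Finsupp.sum_fintype _ _ (fun _ => rfl)] at this
      simpa using this
  rw [hilbertDegree, if_neg hQ0, hdeg]
  simp

lemma mixedSum_eq_sum_Icc (d : ℕ → ℕ) (e : ℕ → ℚ) (l : ℕ) :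
    mixedSum d e 0 l = ∑ q ∈ Finset.Icc 1 (l + 1),
      (-1) ^ (l + 1 - q) * e q * completeSum d (Finset.Icc 1 q) (l + 1 - q) := by
  rw [mixedSum, ← Finset.Ico_add_one_right_eq_Icc, Finset.sum_Ico_eq_sum_range]
  refine Finset.sum_congr rfl fun c _ => ?_
  rw [zero_add, show l + 1 - (1 + c) = l - c by omega]

theorem theorem5p2 {k A : Type*} [Field k] [CommRing A] [Algebra k A]
    (𝒜 : ℕ → Submodule k A) [GradedAlgebra 𝒜] (hA : IsStandardGraded 𝒜)
    (r : ℕ) (hr : 1 ≤ r) (f : ℕ → A) (d : ℕ → ℕ)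
    (hf : ∀ j ∈ Set.Icc 1 r, f j ∈ 𝒜 (d j))
    (hd : MonotoneOn d (Set.Icc 1 r))
    (hseq : IsDSequence r f)
    (I : Ideal A) (hI : I = Ideal.span (f '' Set.Icc 1 r)) :
    -- `δ q = dim A/I_q`, `e q = e(A/I_q)`, and `P` is the Hilbert polynomial of `A[It]`
    ∃ (δ e : ℕ → ℕ) (s : ℤ) (m : ℕ) (P : MvPolynomial (Fin 2) ℚ),
      (∀ q ∈ Set.Icc 1 r, ringKrullDim (A ⧸ colonIdeal f q) = (δ q : WithBot ℕ∞)) ∧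
      (∀ q ∈ Set.Icc 1 r, IsMultiplicity (quotientHilbertFun 𝒜 (colonIdeal f q)) (e q)) ∧
      s = (δ 1 : ℤ) - 1 ∧
      IsGreatest {q : ℕ | q ∈ Set.Icc 1 r ∧ (δ q : ℤ) + q - 2 = s} m ∧
      IsBigradedHilbertPolynomial ((Finset.Icc 1 r).sup d) (reesHilbertFun 𝒜 I) P ∧
      hilbertDegree P = s ∧
      ∀ i : ℕ, (i : ℤ) ≤ s →
        mixedMultiplicity P i =
          ∑ q ∈ Finset.Icc 1 (min m (s - i + 1).toNat),
            (-1 : ℚ) ^ (s - q - i + 1).toNat * (e q : ℚ) *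
              ∑ j ∈ Finset.piAntidiag (Finset.Icc 1 q) (s - q - i + 1).toNat,
                ∏ l ∈ Finset.Icc 1 q, (d l : ℚ) ^ j l := by
  have hI' : I = partialIdeal f r := hI
  subst hI'
  have hex : ∀ q, ∃ (δ e u₀ : ℕ) (p : ℚ[X]), q ∈ Set.Icc 1 r →
      ringKrullDim (A ⧸ colonIdeal f q) = (δ : WithBot ℕ∞) ∧
      IsMultiplicity (quotientHilbertFun 𝒜 (colonIdeal f q)) e ∧
      (∀ u, u₀ ≤ u → (quotientHilbertFun 𝒜 (colonIdeal f q) u : ℚ) = p.eval (u : ℚ)) ∧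
      ((p = 0 ∧ δ = 0) ∨ (p ≠ 0 ∧ p.natDegree + 1 = δ)) ∧
      (p ≠ 0 → 0 < e ∧ (e : ℚ) = (p.natDegree.factorial : ℚ) * p.leadingCoeff) := by
    intro q
    by_cases hq : q ∈ Set.Icc 1 r
    · obtain ⟨i, rfl⟩ : ∃ i, q = i + 1 := ⟨q - 1, by have := hq.1; omega⟩
      have hi : i < r := hq.2
      have hhom := colonIdeal_isHomogeneous hf hi
      obtain ⟨p, hp⟩ := hA.exists_isHilbertPolynomial _ hhom
      obtain ⟨δ, hδ, hδp⟩ := hA.exists_ringKrullDim hhom (hseq.colonIdeal_ne_top hi) hp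
      obtain ⟨e, he, hep⟩ := exists_isMultiplicity hp
      obtain ⟨u₀, hu⟩ := hp
      exact ⟨δ, e, u₀, p, fun _ => ⟨hδ, he, hu, hδp, hep⟩⟩
    · exact ⟨0, 0, 0, 0, fun h => absurd h hq⟩
  choose δ e w p hall using hex
  have hδ := fun q hq => (hall q hq).1
  have hmult := fun q hq => (hall q hq).2.1
  have hhilb := fun q hq => (hall q hq).2.2.1
  have hdeg := fun q hq => (hall q hq).2.2.2.1
  have hlead := fun q hq => (hall q hq).2.2.2.2
  have hstep : ∀ q, q ∈ Set.Icc 1 r → q + 1 ∈ Set.Icc 1 r → δ (q + 1) + (q + 1) ≤ δ q + q := by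
    intro q hq hq'
    obtain ⟨i, rfl⟩ : ∃ i, q = i + 1 := ⟨q - 1, by have := hq.1; omega⟩
    have h1 := hseq.ringKrullDim_succ_le (i := i) hq'.2
    rw [hδ _ hq, hδ _ hq'] at h1
    have h2 : δ (i + 1 + 1) + 1 ≤ δ (i + 1) := by exact_mod_cast h1
    omega
  have hanti : ∀ a b, 1 ≤ a → a ≤ b → b ≤ r → δ b + b ≤ δ a + a := by
    intro a b ha hab
    induction b, hab using Nat.le_induction with
    | base => exact fun _ => le_rfl
    | succ b hab ih =>
      intro hb
      exact (hstep b ⟨by omega, by omega⟩ ⟨by omega, hb⟩).trans (ih (by omega))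
  obtain ⟨m, hm⟩ : ∃ m, IsGreatest {q : ℕ | q ∈ Set.Icc 1 r ∧ (δ q : ℤ) + q - 2 = (δ 1 : ℤ) - 1}
      m := by
    have hfin : {q : ℕ | q ∈ Set.Icc 1 r ∧ (δ q : ℤ) + q - 2 = (δ 1 : ℤ) - 1}.Finite :=
      (Set.finite_Icc 1 r).subset fun q hq => hq.1
    have hne : {q : ℕ | q ∈ Set.Icc 1 r ∧ (δ q : ℤ) + q - 2 = (δ 1 : ℤ) - 1}.Nonempty :=
      ⟨1, ⟨le_rfl, hr⟩, by push_cast; ring⟩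
    exact ⟨sSup _, Nat.sSup_mem hne hfin.bddAbove, fun q hq => le_csSup hfin.bddAbove hq⟩
  obtain ⟨⟨hm1, hmr⟩, hmδ⟩ := hm.1
  have hle_m : ∀ q, 1 ≤ q → q ≤ m → δ q + q = δ 1 + 1 := by
    intro q hq1 hqm
    have h1 := hanti 1 q le_rfl hq1 (hqm.trans hmr)
    have h2 := hanti q m hq1 hqm hmr
    omega
  have hgt_m : ∀ q, m < q → q ≤ r → δ q + q < δ 1 + 1 := by
    intro q hqm hqr
    refine lt_of_le_of_ne (hanti 1 q le_rfl (by omega) hqr) fun heq => ?_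
    have := hm.2 (show q ∈ _ from ⟨⟨by omega, hqr⟩, by omega⟩)
    omega
  set D := δ 1 with hD
  set c := (Finset.Icc 1 r).sup d with hc
  set u₀ := (Finset.Icc 1 r).sup w with hu₀
  -- E q reads off the normalized coefficient in the maximal possible degree D - q, which may
  -- vanish, rather than the multiplicity itself.
  set E : ℕ → ℚ := fun q => if q ≤ r then ((D - q).factorial : ℚ) * (p q).coeff (D - q) else 0
    with hE
  have hdc : ∀ q ∈ Set.Icc 1 r, d q ≤ c := fun q hq => Finset.le_sup (Finset.mem_Icc.mpr hq)
  have hwu : ∀ q ∈ Set.Icc 1 r, w q ≤ u₀ := fun q hq => Finset.le_sup (Finset.mem_Icc.mpr hq)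
  -- Here p q has degree exactly D - q. The bound q ≤ D excludes q = D + 1, where A/I_q has
  -- dimension 0 and e q is a length invisible to p q.
  have hEm : ∀ q, 1 ≤ q → q ≤ m → q ≤ D → E q = e q ∧ 0 < e q := by
    intro q hq1 hqm hqD
    have hq : q ∈ Set.Icc 1 r := ⟨hq1, hqm.trans hmr⟩
    have h1 := hle_m q hq1 hqm
    rcases hdeg q hq with ⟨-, h0⟩ | ⟨h0, h2⟩
    · omega
    · obtain ⟨h3, h4⟩ := hlead q hq h0
      have h5 : (p q).natDegree = D - q := by omega
      refine ⟨?_, h3⟩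
      rw [h4, hE]
      simp only
      rw [if_pos hq.2, ← h5]
      rfl
  have hE0 : ∀ q, m < q → E q = 0 := by
    intro q hqm
    rw [hE]
    simp only
    split_ifs with hqr
    · have h1 := hgt_m q hqm hqr
      rcases hdeg q ⟨by omega, hqr⟩ with ⟨h0, -⟩ | ⟨h0, h2⟩
      · rw [h0]; simp
      · rw [Polynomial.coeff_eq_zero_of_natDegree_lt (by omega), mul_zero]
    · rfl
  obtain ⟨Q, hQ, hQh, hQs⟩ := exists_bivariate_of_recursion r D c u₀ d hdc
    (powQuotientHilbertFun 𝒜 f r) p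
    (by
      intro u v hv
      rw [powQuotientHilbertFun, ← pow_succ', Nat.sub_add_cancel hv, sub_self])
    (by
      intro i hi u hu
      have hq : i + 1 ∈ Set.Icc 1 r := ⟨by omega, hi⟩
      have h1 := hdc _ hq
      have h2 := hwu _ hq
      obtain ⟨x, rfl⟩ : ∃ x, u = x + d (i + 1) := ⟨u - d (i + 1), by omega⟩
      rw [powQuotientHilbertFun_one hA hf hi, hhilb _ hq x (by omega)]
      push_cast
      rw [add_sub_cancel_right])
    (by
      intro i hi v hv u hu
      have hq : i + 1 ∈ Set.Icc 1 r := ⟨by omega, hi⟩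
      have h1 := hdc _ hq
      rw [mul_add, mul_one] at hu
      obtain ⟨x, rfl⟩ : ∃ x, u = x + d (i + 1) := ⟨u - d (i + 1), by omega⟩
      obtain ⟨n, rfl⟩ : ∃ n, v = n + 1 := ⟨v - 1, by omega⟩
      rw [Nat.add_sub_cancel]
      exact powQuotientHilbertFun_succ hA hseq hf hi n x)
    (by
      intro q hq
      have h1 := hanti 1 q le_rfl hq.1 hq.2
      rcases hdeg q hq with ⟨h0, -⟩ | ⟨h0, h2⟩
      · rw [h0]; exact zero_mem _
      · rw [Polynomial.mem_degreeLT, Polynomial.degree_eq_natDegree h0]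
        exact_mod_cast (by omega : (p q).natDegree < D + 1 - q))
    E (fun q hq => if_pos hq.2) (fun q hq => if_neg (by omega)) 0 (Nat.zero_le r)
  rw [Nat.sub_zero] at hQ hQs
  obtain ⟨hQdeg, hQtot⟩ := hilbertDegree_eq hQ (by
    intro j hj
    rw [hQs j 0 (by omega), mixedSum_zero, (hEm 1 le_rfl hm1 (by omega)).1]
    have := (hEm 1 le_rfl hm1 (by omega)).2
    exact_mod_cast this.ne')
  refine ⟨δ, e, (D : ℤ) - 1, m, Q, hδ, hmult, rfl, hm, ⟨u₀, 1, fun u v hu hv => ?_⟩, hQdeg, ?_⟩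
  · rw [← hQh u v hv hu, powQuotientHilbertFun, partialIdeal_zero, reesHilbertFun_eq]
    have : gradedPart 𝒜 (⊥ * partialIdeal f r ^ (v - 1)) u = ⊥ := by
      rw [Ideal.bot_mul, eq_bot_iff]
      exact fun x hx => hx.2
    rw [this, finrank_bot, Nat.cast_zero, sub_zero]
  · intro i hi
    obtain ⟨l, hl⟩ : ∃ l, i + l + 1 = D := ⟨D - 1 - i, by omega⟩
    have h1 : mixedMultiplicity Q i = bivSymbol Q i l := by
      rw [mixedMultiplicity, hQtot, show D - 1 - i = l by omega]
      rfl
    rw [h1, hQs i l hl, mixedSum_eq_sum_Icc]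
    have h2 : ((D : ℤ) - 1 - i + 1).toNat = l + 1 := by omega
    rw [h2]
    symm
    -- Cutting the sum at m loses nothing, since E vanishes beyond m; below it q ≤ l + 1 ≤ D, so E q
    -- is the multiplicity.
    refine Finset.sum_subset_zero_on_sdiff
      (Finset.Icc_subset_Icc_right (min_le_right m (l + 1))) ?_ ?_
    · intro q hq
      simp only [Finset.mem_sdiff, Finset.mem_Icc, le_min_iff, not_and, not_le] at hq
      rw [hE0 q (by omega)]
      ring
    · intro q hq
      rw [Finset.mem_Icc, le_min_iff] at hq
      rw [(hEm q hq.1 hq.2.1 (by omega)).1,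
        show ((D : ℤ) - 1 - q - i + 1).toNat = l + 1 - q by omega]
      rfl
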